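/- Let $n\ge 1$, $s\ge 1$ and $k>0$ be integers. For a compact $n$-dimensional Riemannian manifold $(\Omega,g)$ with smooth boundary (not necessarily connected), let $\lambda^N_0(\Omega,g)\le\lambda^N_1(\Omega,g)\le\dots$ be the Neumann eigenvalues of the Laplace–Beltrami operator, repeated according to multiplicity and indexed from $0$, let $[g]=\{e^{2\omega}g : \omega\in C^\infty(\Omega)\}$ be the conformal class of $g$, and put $$\Lambda^N_k(\Omega,[g])=\sup_{\tilde g\in[g]}\lambda^N_k(\Omega,\tilde g)\,\operatorname{Vol}(\Omega,\tilde g)^{2/n}\in[0,\infty].$$ If $(\Omega,g)=\bigsqcup_{i=1}^s(\Omega_i,g_i)$ is a disjoint union of non-empty connected compact $n$-dimensional Riemannian manifolds with smooth boundary, then $$\Lambda^N_k(\Omega,[g])^{n/2}=\max_{k_1+\dots+k_s=k,\ k_i>0}\ \sum_{i=1}^s\Lambda^N_{k_i}(\Omega_i,[g_i])^{n/2},$$ where $k_1,\dots,k_s$ are integers and the maximum over the empty set (the case $k<s$) is $0$. Similarly, for a closed $n$-dimensional Riemannian manifold $(M,g)$ let $\Lambda_k(M,[g])$ be defined in the same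 way from the eigenvalues $\lambda_0(M,\cdot)\le\lambda_1(M,\cdot)\le\dots$ of the Laplace–Beltrami operator. If $(M,g)=\bigsqcup_{i=1}^s(M_i,g_i)$ is a disjoint union of non-empty connected closed $n$-dimensional Riemannian manifolds, then $$\Lambda_k(M,[g])^{n/2}=\max_{k_1+\dots+k_s=k,\ k_i>0}\ \sum_{i=1}^s\Lambda_{k_i}(M_i,[g_i])^{n/2},$$ with the same convention for $k<s$. -/

import Mathlib

open scoped Manifold ContDiff ENNReal NNReal Topology

noncomputable section

namespace ConformalSpectrum

/-! ### Disjoint unions of manifolds -/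

section DisjointUnion

variable {ι : Type*} {H : Type*} [TopologicalSpace H] [Nonempty H]
  {M : ι → Type*} [∀ i, TopologicalSpace (M i)] [∀ i, ChartedSpace H (M i)]

/-- The disjoint union `⊔ᵢ Mᵢ` as a charted space: its charts are the charts of the `Mᵢ`. -/
instance sigmaChartedSpace : ChartedSpace H (Σ i, M i) where
  atlas := {e | ∃ i, ∃ f ∈ atlas H (M i),
    e = f.lift_openEmbedding (Topology.IsOpenEmbedding.sigmaMk (i := i))}
  chartAt p := (chartAt H p.2).lift_openEmbedding (Topology.IsOpenEmbedding.sigmaMk (i := p.1))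
  mem_chart_source p := ⟨p.2, mem_chart_source H p.2, rfl⟩
  chart_mem_atlas p := ⟨p.1, chartAt H p.2, chart_mem_atlas H p.2, rfl⟩

variable {E : Type*} [NormedAddCommGroup E] [NormedSpace ℝ E]

instance sigmaIsManifold (I : ModelWithCorners ℝ E H) (r : WithTop ℕ∞)
    [∀ i, IsManifold I r (M i)] : IsManifold I r (Σ i, M i) where
  compatible {e e'} he he' := by
    obtain ⟨i, f, hf, rfl⟩ := he
    obtain ⟨j, f', hf', rfl⟩ := he'
    by_cases hij : i = j
    · subst hij
      rw [f.lift_openEmbedding_trans f']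
      exact (contDiffGroupoid r I).compatible hf hf'
    · apply ContDiffGroupoid.mem_of_source_eq_empty
      ext x
      refine ⟨fun ⟨_, y, _, hy⟩ ↦ hij ?_, fun hx ↦ hx.elim⟩
      exact (congrArg Sigma.fst hy).symm

end DisjointUnion

/-! ### Riemannian metrics -/

section Metric

variable {n : ℕ} {H : Type*} [TopologicalSpace H]

/-- Smooth Riemannian metrics on a smooth `n`-dimensional manifold `M` (possibly with boundary). -/
abbrev SmoothMetric (I : ModelWithCorners ℝ (EuclideanSpace ℝ (Fin n)) H) (M : Type*)
    [TopologicalSpace M] [ChartedSpace H M] [IsManifold I ∞ M] :=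
  Bundle.ContMDiffRiemannianMetric I ∞ (EuclideanSpace ℝ (Fin n))
    (fun x : M ↦ TangentSpace I x)

variable {I : ModelWithCorners ℝ (EuclideanSpace ℝ (Fin n)) H}

section Sigma

variable [Nonempty H] {ι : Type*} {M : ι → Type*} [∀ i, TopologicalSpace (M i)]
  [∀ i, ChartedSpace H (M i)]

lemma extChartAt_sigma_apply (i : ι) (x y : M i) :
    extChartAt I (⟨i, x⟩ : Σ i, M i) ⟨i, y⟩ = extChartAt I x y := by
  change I ((chartAt H (⟨i, x⟩ : Σ i, M i)) ⟨i, y⟩) = I (chartAt H x y)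
  congr 1
  exact (chartAt H x).lift_openEmbedding_apply (Topology.IsOpenEmbedding.sigmaMk (i := i))

lemma extChartAt_sigma_symm_apply (i : ι) (x : M i) (z : EuclideanSpace ℝ (Fin n)) :
    (extChartAt I (⟨i, x⟩ : Σ i, M i)).symm z = ⟨i, (extChartAt I x).symm z⟩ := rfl

lemma contMDiffAt_sigma {F : Type*} [NormedAddCommGroup F] [NormedSpace ℝ F] {i : ι} {x : M i}
    {f : (Σ i, M i) → F} (h : ContMDiffAt I 𝓘(ℝ, F) ∞ (fun y ↦ f ⟨i, y⟩) x) :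
    ContMDiffAt I 𝓘(ℝ, F) ∞ f ⟨i, x⟩ := by
  rw [contMDiffAt_iff] at h ⊢
  refine ⟨?_, ?_⟩
  · rw [ContinuousAt, Sigma.nhds_mk, Filter.tendsto_map'_iff]
    exact h.1
  · rw [extChartAt_sigma_apply]
    exact h.2

variable [∀ i, IsManifold I ∞ (M i)]

lemma tangentCoordChange_sigma (i : ι) (x y z : M i) :
    tangentCoordChange I (⟨i, x⟩ : Σ i, M i) ⟨i, y⟩ ⟨i, z⟩ = tangentCoordChange I x y z := by
  rw [tangentCoordChange_def, tangentCoordChange_def, extChartAt_sigma_apply]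
  congr 1
  funext w
  exact extChartAt_sigma_apply i y _

/-- The metric on `⊔ᵢ Mᵢ` that restricts to `gᵢ` on `Mᵢ`. -/
def sigmaMetric (g : ∀ i, SmoothMetric I (M i)) : SmoothMetric I (Σ i, M i) where
  inner p := (g p.1).inner p.2
  symm p := (g p.1).symm p.2
  pos p := (g p.1).pos p.2
  isVonNBounded p := (g p.1).isVonNBounded p.2
  contMDiff := by
    rintro ⟨i, x⟩
    have hx := (g i).contMDiff x
    rw [contMDiffAt_hom_bundle] at hx ⊢
    refine ⟨contMDiffAt_id, contMDiffAt_sigma (hx.2.congr_of_eventuallyEq ?_)⟩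
    filter_upwards [(chartAt H x).open_source.mem_nhds (mem_chart_source H x)] with y hy
    have hy' : (⟨i, y⟩ : Σ i, M i) ∈ (chartAt H (⟨i, x⟩ : Σ i, M i)).source := ⟨y, hy, rfl⟩
    have key (v : EuclideanSpace ℝ (Fin n)) :
        (trivializationAt (EuclideanSpace ℝ (Fin n)) (TangentSpace I)
          (⟨i, x⟩ : Σ i, M i)).symm ⟨i, y⟩ v =
        (trivializationAt (EuclideanSpace ℝ (Fin n)) (TangentSpace I) x).symm y v := by
      have h1 := congrArg (fun T ↦ T v)
        (TangentBundle.symmL_trivializationAt_eq_core (I := I) hy')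
      have h2 := congrArg (fun T ↦ T v)
        (TangentBundle.symmL_trivializationAt_eq_core (I := I) hy)
      have h3 := congrArg (fun T ↦ T v) (tangentCoordChange_sigma (I := I) i x y y)
      have h4 := (h1.trans h3).trans h2.symm
      rwa [Bundle.Trivialization.symmL_apply _ hy', Bundle.Trivialization.symmL_apply _ hy] at h4
    ext v w
    refine (inCoordinates_apply_eq₂ (E₁ := fun p : Σ i, M i ↦ TangentSpace I p)
      (E₂ := fun p : Σ i, M i ↦ TangentSpace I p) (E₃ := Bundle.Trivial (Σ i, M i) ℝ)
      hy' hy' (Set.mem_univ _)).trans (Eq.trans ?_ (inCoordinates_apply_eq₂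
        (E₁ := fun p : M i ↦ TangentSpace I p) (E₂ := fun p : M i ↦ TangentSpace I p)
        (E₃ := Bundle.Trivial (M i) ℝ) hy hy (Set.mem_univ _)).symm)
    rw [key v, key w]
    rfl

/-- The inclusion `Mᵢ → ⊔ⱼ Mⱼ` pulls the metric of the disjoint union back to `gᵢ`. -/
lemma sigmaMetric_pullback (g : ∀ i, SmoothMetric I (M i)) (i : ι) (x : M i) (v w : TangentSpace I x) :
    (sigmaMetric g).inner ⟨i, x⟩ (mfderiv I I (Sigma.mk i) x v) (mfderiv I I (Sigma.mk i) x w) =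
      (g i).inner x v w := by
  have h : HasMFDerivAt I I (Sigma.mk i) x
      (ContinuousLinearMap.id ℝ (EuclideanSpace ℝ (Fin n))) := by
    refine ⟨continuous_sigmaMk.continuousAt, ?_⟩
    refine (hasFDerivWithinAt_id _ _).congr_of_eventuallyEq ?_ ?_
    · filter_upwards [extChartAt_target_mem_nhdsWithin (I := I) x] with y hy
      exact (extChartAt_sigma_apply i x _).trans ((extChartAt I x).right_inv hy)
    · exact (extChartAt_sigma_apply i x _).trans
        ((extChartAt I x).right_inv (mem_extChartAt_target x))
  rw [h.mfderiv]
  rfl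

end Sigma

variable {M : Type*} [TopologicalSpace M] [ChartedSpace H M] [IsManifold I ∞ M]

/-- The conformal class `[g] = {e^{2f} g | f ∈ C^∞(M)}`. -/
def conformalClass (g : SmoothMetric I M) : Set (SmoothMetric I M) :=
  {h | ∃ f : C^∞⟮I, M; 𝓘(ℝ, ℝ), ℝ⟯, ∀ (x : M) (v w : TangentSpace I x),
    h.inner x v w = Real.exp (2 * f x) * g.inner x v w}

/-! ### Riemannian volume -/

/-- The standard basis of `T_x M = ℝⁿ`: the coordinate frame at `x` of the chart at `x`. -/
def frame (I : ModelWithCorners ℝ (EuclideanSpace ℝ (Fin n)) H) (x : M) :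
    Module.Basis (Fin n) ℝ (TangentSpace I x) :=
  (EuclideanSpace.basisFun (Fin n) ℝ).toBasis

/-- The coordinate vector field `∂ᵢ` of the chart at `c`, at the point with coordinates `y`. -/
def coordVector (I : ModelWithCorners ℝ (EuclideanSpace ℝ (Fin n)) H) (c : M)
    (y : EuclideanSpace ℝ (Fin n)) (i : Fin n) : TangentSpace I ((extChartAt I c).symm y) :=
  mfderivWithin 𝓘(ℝ, EuclideanSpace ℝ (Fin n)) I (extChartAt I c).symm (Set.range I) y
    (frame 𝓘(ℝ, EuclideanSpace ℝ (Fin n)) y i)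

/-- The matrix `(g(∂ᵢ, ∂ⱼ))ᵢⱼ` of the metric in the chart at `c`, as a function of the
coordinates `y`. -/
def metricCoeff (g : SmoothMetric I M) (c : M) (y : EuclideanSpace ℝ (Fin n)) :
    Matrix (Fin n) (Fin n) ℝ :=
  Matrix.of fun i j ↦
    g.inner ((extChartAt I c).symm y) (coordVector I c y i) (coordVector I c y j)

/-- The volume measure of `g` on the domain of the chart at `c`: the measure `√(det gᵢⱼ) dy` on the
range of the chart, carried to `M`. It gives mass zero to the complement of the chart domain. -/
def chartVolume (g : SmoothMetric I M) (c : M) : @MeasureTheory.Measure M (borel M) :=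
  @MeasureTheory.Measure.map _ M _ (borel M) (extChartAt I c).symm
    ((MeasureTheory.volume.restrict (extChartAt I c).target).withDensity
      fun y ↦ ENNReal.ofReal (Real.sqrt (metricCoeff g c y).det))

/-- The Riemannian volume measure `dv_g` on the Borel sets of `M`: the smallest measure that
dominates the volume measures of all chart domains. As the latter agree on overlaps, this is
the measure given by `√(det gᵢⱼ) dy` in every chart. -/
def volumeMeasure (g : SmoothMetric I M) : @MeasureTheory.Measure M (borel M) :=
  ⨆ c : M, chartVolume g c

/-- `Vol(M, g)`. -/
def vol (g : SmoothMetric I M) : ℝ≥0∞ := volumeMeasure g Set.univ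

/-! ### Neumann eigenvalues -/

/-- The matrix `(gᵢⱼ)` of `g_x` in the basis `frame I x`. -/
def gramMatrix (g : SmoothMetric I M) (x : M) : Matrix (Fin n) (Fin n) ℝ :=
  Matrix.of fun i j ↦ g.inner x (frame I x i) (frame I x j)

/-- The differential `du` at `x`. -/
def differential (I : ModelWithCorners ℝ (EuclideanSpace ℝ (Fin n)) H) (u : M → ℝ) (x : M) :
    TangentSpace I x →L[ℝ] ℝ :=
  mfderiv I 𝓘(ℝ, ℝ) u x

/-- The gradient `∇u = ∑ᵢⱼ gⁱʲ ∂ⱼu ∂ᵢ` of a function at `x`. -/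
def grad (g : SmoothMetric I M) (u : M → ℝ) (x : M) : TangentSpace I x :=
  ∑ i, ∑ j, ((gramMatrix g x)⁻¹ i j * differential I u x (frame I x j)) • frame I x i

lemma isUnit_det_gramMatrix (g : SmoothMetric I M) (x : M) : IsUnit (gramMatrix g x).det := by
  rw [isUnit_iff_ne_zero]
  intro h0
  obtain ⟨a, ha, hGa⟩ := Matrix.exists_mulVec_eq_zero_iff.2 h0
  set v : TangentSpace I x := ∑ i, a i • frame I x i with hv
  have hv0 : v ≠ 0 := fun h ↦ ha <| funext fun i ↦
    (Fintype.linearIndependent_iff.1 (frame I x).linearIndependent a h i)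
  have hzero (i : Fin n) : g.inner x (frame I x i) v = 0 := by
    have := congrFun hGa i
    simpa [hv, Matrix.mulVec, dotProduct, gramMatrix, mul_comm] using this
  refine (g.pos x v hv0).ne' ?_
  have : g.inner x v v = ∑ i, a i * g.inner x (frame I x i) v := by
    conv_lhs => rw [g.symm, hv, map_sum]
    refine Finset.sum_congr rfl fun i _ ↦ ?_
    rw [map_smul, smul_eq_mul, g.symm]
  rw [this]
  simp [hzero]

/-- The gradient represents the differential: `g(∇u, v) = du(v)`. -/
lemma inner_grad (g : SmoothMetric I M) (u : M → ℝ) (x : M) (v : TangentSpace I x) :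
    g.inner x (grad g u x) v = differential I u x v := by
  set D := differential I u x with hD
  have hG : gramMatrix g x * (gramMatrix g x)⁻¹ = 1 :=
    Matrix.mul_nonsing_inv _ (isUnit_det_gramMatrix g x)
  have key : (g.inner x (grad g u x)).toLinearMap = D.toLinearMap := by
    refine (frame I x).ext fun l ↦ ?_
    change g.inner x (grad g u x) (frame I x l) = D (frame I x l)
    rw [g.symm, grad, map_sum]
    calc ∑ i, g.inner x (frame I x l)
          (∑ j, ((gramMatrix g x)⁻¹ i j * D (frame I x j)) • frame I x i)
        = ∑ i, ∑ j, gramMatrix g x l i * (gramMatrix g x)⁻¹ i j * D (frame I x j) := by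
          refine Finset.sum_congr rfl fun i _ ↦ ?_
          rw [map_sum]
          refine Finset.sum_congr rfl fun j _ ↦ ?_
          rw [map_smul, smul_eq_mul, gramMatrix, Matrix.of_apply]
          ring
      _ = ∑ j, (gramMatrix g x * (gramMatrix g x)⁻¹) l j * D (frame I x j) := by
          rw [Finset.sum_comm]
          simp only [Matrix.mul_apply, Finset.sum_mul]
      _ = D (frame I x l) := by
          rw [hG]
          simp [Matrix.one_apply]
  exact congrArg (fun T : TangentSpace I x →ₗ[ℝ] ℝ ↦ T v) key

/-- `u ∈ C^∞(M)` solves the Neumann eigenvalue problem `Δu = μu` in `M`, `∂u/∂ν = 0` on `∂M`, in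
variational form: `∫ ⟨∇u, ∇φ⟩ dv_g = μ ∫ u φ dv_g` for all `φ ∈ C^∞(M)`. (Functions in `C^∞(M)` are
smooth up to the boundary. If `∂M = ∅`, this is `Δu = μu`.) -/
def IsNeumannSolution (g : SmoothMetric I M) (μ : ℝ) (u : C^∞⟮I, M; 𝓘(ℝ, ℝ), ℝ⟯) : Prop :=
  ∀ φ : C^∞⟮I, M; 𝓘(ℝ, ℝ), ℝ⟯,
    ∫ x, g.inner x (grad g u x) (grad g φ x) ∂(volumeMeasure g) =
      μ * ∫ x, u x * φ x ∂(volumeMeasure g)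

/-- The span of all eigenfunctions with eigenvalue at most `L`. Its dimension is the number of
eigenvalues in `[0, L]`, counted with multiplicity. -/
def spectralSpace (g : SmoothMetric I M) (L : ℝ) : Submodule ℝ C^∞⟮I, M; 𝓘(ℝ, ℝ), ℝ⟯ :=
  Submodule.span ℝ {u | ∃ μ ≤ L, IsNeumannSolution g μ u}

/-- The `k`-th Neumann eigenvalue `λ_k(M, g)`, where `0 = λ_0 ≤ λ_1 ≤ λ_2 ≤ …` are the eigenvalues
repeated according to multiplicity: the least `L` such that at least `k + 1` eigenvalues, counted
with multiplicity, are at most `L`. If `∂M = ∅`, it is the `k`-th eigenvalue of the Laplacian. -/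
def eigenvalue (g : SmoothMetric I M) (k : ℕ) : ℝ≥0∞ :=
  ⨅ (L : ℝ≥0) (_ : ((k + 1 : ℕ) : Cardinal) ≤ Module.rank ℝ (spectralSpace g L)), (L : ℝ≥0∞)

/-- The normalized eigenvalue `λ_k(M, g) Vol(M, g)^{2/n}`. -/
def normalizedEigenvalue (g : SmoothMetric I M) (k : ℕ) : ℝ≥0∞ :=
  eigenvalue g k * vol g ^ (2 / n : ℝ)

/-- The conformal eigenvalue `Λ_k(M, [g])`: the supremum of the normalized eigenvalue over `[g]`,
taken in `[0, ∞]`. -/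
def conformalEigenvalue (g : SmoothMetric I M) (k : ℕ) : ℝ≥0∞ :=
  ⨆ h ∈ conformalClass g, normalizedEigenvalue h k

end Metric

end ConformalSpectrum

end

open ConformalSpectrum

noncomputable section

namespace ConformalSpectrum

universe u

open MeasureTheory Set

section Coordinates

variable {n : ℕ} {H : Type*} [TopologicalSpace H]
  {I : ModelWithCorners ℝ (EuclideanSpace ℝ (Fin n)) H}
  {M : Type*} [TopologicalSpace M] [ChartedSpace H M] [IsManifold I ∞ M]

/-- The inner product of `g` at `x`, as a bilinear form on the model space. -/
def innerForm (g : SmoothMetric I M) (x : M) :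
    EuclideanSpace ℝ (Fin n) →L[ℝ] EuclideanSpace ℝ (Fin n) →L[ℝ] ℝ :=
  g.inner x

/-- The derivative of the inverse of the chart at `c`. -/
def coordDeriv (I : ModelWithCorners ℝ (EuclideanSpace ℝ (Fin n)) H) (c : M)
    (y : EuclideanSpace ℝ (Fin n)) : EuclideanSpace ℝ (Fin n) →L[ℝ] EuclideanSpace ℝ (Fin n) :=
  mfderivWithin 𝓘(ℝ, EuclideanSpace ℝ (Fin n)) I (extChartAt I c).symm (Set.range I) y

/-- The metric in the chart at `c`, as a bilinear form. -/
def coordForm (g : SmoothMetric I M) (c : M) (y : EuclideanSpace ℝ (Fin n)) :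
    EuclideanSpace ℝ (Fin n) →L[ℝ] EuclideanSpace ℝ (Fin n) →L[ℝ] ℝ :=
  (innerForm g ((extChartAt I c).symm y)).bilinearComp (coordDeriv I c y) (coordDeriv I c y)

lemma coordForm_apply (g : SmoothMetric I M) (c : M) (y v w : EuclideanSpace ℝ (Fin n)) :
    coordForm g c y v w =
      innerForm g ((extChartAt I c).symm y) (coordDeriv I c y v) (coordDeriv I c y w) := rfl

lemma metricCoeff_eq_toMatrix (g : SmoothMetric I M) (c : M) (y : EuclideanSpace ℝ (Fin n)) :
    metricCoeff g c y = LinearMap.BilinForm.toMatrix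
      (EuclideanSpace.basisFun (Fin n) ℝ).toBasis (coordForm g c y).toBilinForm := by
  ext i j
  rw [LinearMap.BilinForm.toMatrix_apply]
  rfl

lemma mdifferentiableWithinAt_symm {c : M} {y : EuclideanSpace ℝ (Fin n)}
    (hy : y ∈ (extChartAt I c).target) :
    MDifferentiableWithinAt 𝓘(ℝ, EuclideanSpace ℝ (Fin n)) I (extChartAt I c).symm (range I) y :=
  have : IsManifold I 1 M := IsManifold.of_le (n := ∞) (by simp)
  mdifferentiableWithinAt_extChartAt_symm hy

omit [IsManifold I ∞ M] in
lemma mem_range_of_mem_target {c : M} {y : EuclideanSpace ℝ (Fin n)}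
    (hy : y ∈ (extChartAt I c).target) : y ∈ range I :=
  extChartAt_target_subset_range c hy

/-- Chain rule for a function read in a chart. -/
lemma differential_coordDeriv {u : M → ℝ} {c : M} {y : EuclideanSpace ℝ (Fin n)}
    (hy : y ∈ (extChartAt I c).target)
    (hu : MDifferentiableAt I 𝓘(ℝ, ℝ) u ((extChartAt I c).symm y)) (v : EuclideanSpace ℝ (Fin n)) :
    differential I u ((extChartAt I c).symm y) (coordDeriv I c y v) =
      fderivWithin ℝ (u ∘ (extChartAt I c).symm) (range I) y v := by
  have h := mfderiv_comp_mfderivWithin (I := 𝓘(ℝ, EuclideanSpace ℝ (Fin n))) (I' := I)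
    (I'' := 𝓘(ℝ, ℝ)) (x := y) (s := range I) hu (mdifferentiableWithinAt_symm hy)
    (I.uniqueMDiffOn  y (mem_range_of_mem_target hy))
  rw [← mfderivWithin_eq_fderivWithin, h]
  rfl

lemma coordDeriv_injective {c : M} {y : EuclideanSpace ℝ (Fin n)}
    (hy : y ∈ (extChartAt I c).target) : Function.Injective (coordDeriv I c y) :=
  have : IsManifold I 1 M := IsManifold.of_le (n := ∞) (by simp)
  (isInvertible_mfderivWithin_extChartAt_symm hy).injective

/-- Chain rule for the change of charts. -/
lemma coordDeriv_change {c d : M} {y : EuclideanSpace ℝ (Fin n)}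
    (hy : y ∈ (extChartAt I c).target) (hd : (extChartAt I c).symm y ∈ (extChartAt I d).source) :
    HasFDerivWithinAt (extChartAt I d ∘ (extChartAt I c).symm)
      (fderivWithin ℝ (extChartAt I d ∘ (extChartAt I c).symm) (range I) y) (range I) y ∧
    ∀ v, coordDeriv I c y v = coordDeriv I d (extChartAt I d ((extChartAt I c).symm y))
      (fderivWithin ℝ (extChartAt I d ∘ (extChartAt I c).symm) (range I) y v) := by
  have : IsManifold I 1 M := IsManifold.of_le (n := ∞) (by simp)
  have hyr := mem_range_of_mem_target hy
  have hφ : MDifferentiableWithinAt 𝓘(ℝ, EuclideanSpace ℝ (Fin n))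
      𝓘(ℝ, EuclideanSpace ℝ (Fin n)) (extChartAt I d ∘ (extChartAt I c).symm) (range I) y :=
    (mdifferentiableAt_extChartAt (by simpa using hd)).comp_mdifferentiableWithinAt y
      (mdifferentiableWithinAt_symm hy)
  refine ⟨hφ.differentiableWithinAt.hasFDerivWithinAt, fun v ↦ ?_⟩
  have hcomp := mfderivWithin_comp (I := 𝓘(ℝ, EuclideanSpace ℝ (Fin n)))
    (I' := 𝓘(ℝ, EuclideanSpace ℝ (Fin n))) (I'' := I)
    (f := extChartAt I d ∘ (extChartAt I c).symm) (g := (extChartAt I d).symm) (s := range I)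
    (u := range I) y (mdifferentiableWithinAt_symm ((extChartAt I d).map_source hd)) hφ
    (fun z _ ↦ mem_range_self _) (I.uniqueMDiffOn y hyr)
  have heq : (extChartAt I c).symm =ᶠ[𝓝[range I] y]
      (extChartAt I d).symm ∘ (extChartAt I d ∘ (extChartAt I c).symm) := by
    have h1 := (mdifferentiableWithinAt_symm hy).continuousWithinAt.preimage_mem_nhdsWithin
      ((isOpen_extChartAt_source (I := I) d).mem_nhds hd)
    filter_upwards [h1] with z hz
    exact ((extChartAt I d).left_inv hz).symm
  have h2 := heq.mfderivWithin_eq (I := 𝓘(ℝ, EuclideanSpace ℝ (Fin n))) (I' := I)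
    ((extChartAt I d).left_inv hd).symm
  have h3 : coordDeriv I c y = (coordDeriv I d (extChartAt I d ((extChartAt I c).symm y))).comp
      (mfderivWithin 𝓘(ℝ, EuclideanSpace ℝ (Fin n)) 𝓘(ℝ, EuclideanSpace ℝ (Fin n))
        (extChartAt I d ∘ (extChartAt I c).symm) (range I) y) := h2.trans hcomp
  rw [h3, mfderivWithin_eq_fderivWithin]
  rfl

lemma coordForm_change (g : SmoothMetric I M) {c d : M} {y : EuclideanSpace ℝ (Fin n)}
    (hy : y ∈ (extChartAt I c).target) (hd : (extChartAt I c).symm y ∈ (extChartAt I d).source)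
    (v w : EuclideanSpace ℝ (Fin n)) :
    coordForm g c y v w = coordForm g d (extChartAt I d ((extChartAt I c).symm y))
      (fderivWithin ℝ (extChartAt I d ∘ (extChartAt I c).symm) (range I) y v)
      (fderivWithin ℝ (extChartAt I d ∘ (extChartAt I c).symm) (range I) y w) := by
  rw [coordForm_apply, coordForm_apply, ← (coordDeriv_change hy hd).2,
    ← (coordDeriv_change hy hd).2, (extChartAt I d).left_inv hd]

lemma det_metricCoeff_change (g : SmoothMetric I M) {c d : M} {y : EuclideanSpace ℝ (Fin n)}
    (hy : y ∈ (extChartAt I c).target) (hd : (extChartAt I c).symm y ∈ (extChartAt I d).source) :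
    (metricCoeff g c y).det =
      (fderivWithin ℝ (extChartAt I d ∘ (extChartAt I c).symm) (range I) y).det ^ 2 *
        (metricCoeff g d (extChartAt I d ((extChartAt I c).symm y))).det := by
  set A := fderivWithin ℝ (extChartAt I d ∘ (extChartAt I c).symm) (range I) y with hA
  have h : (coordForm g c y).toBilinForm =
      (coordForm g d (extChartAt I d ((extChartAt I c).symm y))).toBilinForm.comp
        A.toLinearMap A.toLinearMap := by
    ext v w
    exact coordForm_change g hy hd v w
  rw [metricCoeff_eq_toMatrix, h, LinearMap.BilinForm.toMatrix_comp
    (EuclideanSpace.basisFun (Fin n) ℝ).toBasis, ← metricCoeff_eq_toMatrix, Matrix.det_mul,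
    Matrix.det_mul, Matrix.det_transpose, LinearMap.det_toMatrix]
  change LinearMap.det A.toLinearMap * _ * LinearMap.det A.toLinearMap =
    LinearMap.det A.toLinearMap ^ 2 * _
  ring

lemma posDef_metricCoeff (g : SmoothMetric I M) {c : M} {y : EuclideanSpace ℝ (Fin n)}
    (hy : y ∈ (extChartAt I c).target) : (metricCoeff g c y).PosDef := by
  refine Matrix.PosDef.of_dotProduct_mulVec_pos ?_ fun {a} ha ↦ ?_
  · ext i j
    exact g.symm _ _ _
  · have hform : ∀ a : Fin n → ℝ, star a ⬝ᵥ (metricCoeff g c y).mulVec a =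
        coordForm g c y (WithLp.toLp 2 a) (WithLp.toLp 2 a) := by
      intro a
      have h := LinearMap.BilinForm.apply_eq_dotProduct_toMatrix_mulVec
        (EuclideanSpace.basisFun (Fin n) ℝ).toBasis (coordForm g c y).toBilinForm
        (WithLp.toLp 2 a) (WithLp.toLp 2 a)
      rw [← metricCoeff_eq_toMatrix] at h
      exact h.symm
    rw [hform]
    refine g.pos _ _ fun h0 ↦ ha ?_
    have := coordDeriv_injective hy (h0.trans (map_zero (coordDeriv I c y)).symm)
    simpa using this

set_option synthInstance.maxHeartbeats 200000 in
lemma continuousOn_coordForm (g : SmoothMetric I M) (c : M) :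
    ContinuousOn (coordForm g c) (extChartAt I c).target := by
  have : IsManifold I 1 M := IsManifold.of_le (n := ∞) (by simp)
  have key : ContinuousOn (fun x ↦ coordForm g c (extChartAt I c x)) (chartAt H c).source := by
    intro x hx
    have h1 := (Bundle.Trivialization.contMDiffAt_section_iff (n := ∞) (trivializationAt
      (EuclideanSpace ℝ (Fin n) →L[ℝ] EuclideanSpace ℝ (Fin n) →L[ℝ] ℝ)
      (fun x : M ↦ TangentSpace I x →L[ℝ] TangentSpace I x →L[ℝ] ℝ) c)
      (x₀ := x) (by exact ⟨hx, hx, trivial⟩)).1 (g.contMDiff x)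
    refine ContinuousAt.continuousWithinAt (h1.continuousAt.congr ?_)
    filter_upwards [(chartAt H c).open_source.mem_nhds hx] with z hz
    rw [hom_trivializationAt_apply]
    ext v w
    refine (inCoordinates_apply_eq₂
        (E₁ := fun p : M ↦ TangentSpace I p) (E₂ := fun p : M ↦ TangentSpace I p)
        (E₃ := Bundle.Trivial M ℝ) hz hz (Set.mem_univ _)).trans ?_
    have h2 (v : EuclideanSpace ℝ (Fin n)) : (trivializationAt (EuclideanSpace ℝ (Fin n))
        (TangentSpace I) c).symm z v = coordDeriv I c (extChartAt I c z) v := by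
      have := congrArg (fun T ↦ T v) (TangentBundle.symmL_trivializationAt (I := I) hz)
      rwa [Bundle.Trivialization.symmL_apply _ hz] at this
    have h3 (r : ℝ) : (trivializationAt ℝ (Bundle.Trivial M ℝ) c).linearMapAt ℝ z r = r := by
      simp
    rw [coordForm_apply, (extChartAt I c).left_inv (by simpa using hz), ← h2, ← h2]
    exact h3 _
  refine (key.comp (continuousOn_extChartAt_symm c) fun y hy ↦ ?_).congr fun y hy ↦ ?_
  · simpa using (extChartAt I c).map_target hy
  · exact (congrArg (coordForm g c) ((extChartAt I c).right_inv hy)).symm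

lemma continuousOn_metricCoeff (g : SmoothMetric I M) (c : M) :
    ContinuousOn (metricCoeff g c) (extChartAt I c).target := by
  refine continuousOn_pi.2 fun i ↦ continuousOn_pi.2 fun j ↦ ?_
  exact ((continuousOn_coordForm g c).clm_apply continuousOn_const).clm_apply continuousOn_const

/-- The gradient pairing expressed in an arbitrary basis of the tangent space. -/
lemma inner_grad_grad_eq_sum (g : SmoothMetric I M) (u φ : M → ℝ) (x : M)
    (b : Fin n → TangentSpace I x) (hb : LinearIndependent ℝ b) (G : Matrix (Fin n) (Fin n) ℝ)
    (hG : ∀ i j, G i j = g.inner x (b i) (b j)) (hdet : IsUnit G.det) :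
    g.inner x (grad g u x) (grad g φ x) =
      ∑ i, ∑ j, G⁻¹ i j * differential I u x (b i) * differential I φ x (b j) := by
  have : FiniteDimensional ℝ (TangentSpace I x) :=
    inferInstanceAs (FiniteDimensional ℝ (EuclideanSpace ℝ (Fin n)))
  have hspan : ⊤ ≤ Submodule.span ℝ (range b) := by
    refine (hb.span_eq_top_of_card_eq_finrank' ?_).ge
    exact (finrank_euclideanSpace_fin (𝕜 := ℝ) (n := n)).symm ▸ Fintype.card_fin n
  obtain ⟨a, ha⟩ : ∃ a : Fin n → ℝ, ∑ i, a i • b i = grad g u x :=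
    (Submodule.mem_span_range_iff_exists_fun ℝ).1 (hspan trivial)
  have h1 : ∀ j, differential I u x (b j) = Matrix.vecMul a G j := by
    intro j
    rw [← inner_grad, ← ha, map_sum, Matrix.vecMul, dotProduct]
    simp [hG]
  have h2 : ∀ j, a j = ∑ i, G⁻¹ i j * differential I u x (b i) := by
    intro j
    have : Matrix.vecMul (Matrix.vecMul a G) G⁻¹ j = a j := by
      rw [Matrix.vecMul_vecMul, Matrix.mul_nonsing_inv _ hdet, Matrix.vecMul_one]
    rw [← this, Matrix.vecMul, dotProduct]
    exact Finset.sum_congr rfl fun i _ ↦ by rw [h1, mul_comm]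
  rw [g.symm, inner_grad, ← ha, map_sum, Finset.sum_comm]
  refine Finset.sum_congr rfl fun j _ ↦ ?_
  rw [map_smul, smul_eq_mul, h2, Finset.sum_mul]

end Coordinates

section Gradient

variable {n : ℕ} {H : Type*} [TopologicalSpace H]
  {I : ModelWithCorners ℝ (EuclideanSpace ℝ (Fin n)) H}
  {M : Type*} [TopologicalSpace M] [ChartedSpace H M] [IsManifold I ∞ M]

lemma contDiffWithinAt_comp_symm (u : C^∞⟮I, M; 𝓘(ℝ, ℝ), ℝ⟯) {c : M}
    {y : EuclideanSpace ℝ (Fin n)} (hy : y ∈ (extChartAt I c).target) :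
    ContDiffWithinAt ℝ ∞ (u ∘ (extChartAt I c).symm) (range I) y := by
  have h := (u.contMDiff ((extChartAt I c).symm y)).comp_contMDiffWithinAt y
    (contMDiffWithinAt_extChartAt_symm_range c hy)
  exact h.contDiffWithinAt

lemma continuousWithinAt_fderivWithin (u : C^∞⟮I, M; 𝓘(ℝ, ℝ), ℝ⟯) {c : M}
    {y : EuclideanSpace ℝ (Fin n)} (hy : y ∈ (extChartAt I c).target) :
    ContinuousWithinAt (fderivWithin ℝ (u ∘ (extChartAt I c).symm) (range I)) (range I) y :=
  ((contDiffWithinAt_comp_symm u hy).fderivWithin_right (m := 0) I.uniqueDiffOn (by simp)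
    (mem_range_of_mem_target hy)).continuousWithinAt

lemma linearIndependent_coordVector {c : M} {y : EuclideanSpace ℝ (Fin n)}
    (hy : y ∈ (extChartAt I c).target) : LinearIndependent ℝ (coordVector I c y) :=
  (EuclideanSpace.basisFun (Fin n) ℝ).toBasis.linearIndependent.map' (coordDeriv I c y).toLinearMap
    (LinearMap.ker_eq_bot.2 (coordDeriv_injective hy))

omit [IsManifold I ∞ M] in
lemma mdifferentiableAt_smooth (u : C^∞⟮I, M; 𝓘(ℝ, ℝ), ℝ⟯) (x : M) :
    MDifferentiableAt I 𝓘(ℝ, ℝ) u x :=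
  (u.contMDiff x).mdifferentiableAt (by simp)

/-- The gradient pairing in a chart: `⟨∇u, ∇φ⟩ = ∑ gⁱʲ ∂ᵢu ∂ⱼφ`. -/
lemma inner_grad_grad_symm (g : SmoothMetric I M) (u φ : C^∞⟮I, M; 𝓘(ℝ, ℝ), ℝ⟯) {c : M}
    {y : EuclideanSpace ℝ (Fin n)} (hy : y ∈ (extChartAt I c).target) :
    g.inner ((extChartAt I c).symm y) (grad g u _) (grad g φ _) =
      ∑ i, ∑ j, (metricCoeff g c y)⁻¹ i j *
        fderivWithin ℝ (u ∘ (extChartAt I c).symm) (range I) y (EuclideanSpace.basisFun _ ℝ i) *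
        fderivWithin ℝ (φ ∘ (extChartAt I c).symm) (range I) y
          (EuclideanSpace.basisFun _ ℝ j) := by
  rw [inner_grad_grad_eq_sum g u φ _ (coordVector I c y) (linearIndependent_coordVector hy)
    (metricCoeff g c y) (fun _ _ ↦ rfl) (posDef_metricCoeff g hy).det_pos.ne'.isUnit]
  refine Finset.sum_congr rfl fun i _ ↦ Finset.sum_congr rfl fun j _ ↦ ?_
  rw [← differential_coordDeriv hy (mdifferentiableAt_smooth u _),
    ← differential_coordDeriv hy (mdifferentiableAt_smooth φ _)]
  simp only [coordVector, frame, coordDeriv]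
  rfl

lemma continuous_inner_grad_grad (g : SmoothMetric I M) (u φ : C^∞⟮I, M; 𝓘(ℝ, ℝ), ℝ⟯) :
    Continuous fun x ↦ g.inner x (grad g u x) (grad g φ x) := by
  refine continuous_iff_continuousAt.2 fun c ↦ ?_
  have hF : ContinuousOn (fun y ↦ g.inner ((extChartAt I c).symm y) (grad g u _) (grad g φ _))
      (extChartAt I c).target := by
    refine ContinuousOn.congr (f := fun y ↦ ∑ i, ∑ j, (metricCoeff g c y)⁻¹ i j *
        fderivWithin ℝ (u ∘ (extChartAt I c).symm) (range I) y (EuclideanSpace.basisFun _ ℝ i) *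
        fderivWithin ℝ (φ ∘ (extChartAt I c).symm) (range I) y
          (EuclideanSpace.basisFun _ ℝ j)) ?_ fun y hy ↦ inner_grad_grad_symm g u φ hy
    refine continuousOn_finsetSum _ fun i _ ↦ continuousOn_finsetSum _ fun j _ ↦ ?_
    have hd (v : C^∞⟮I, M; 𝓘(ℝ, ℝ), ℝ⟯) (i : Fin n) : ContinuousOn (fun y ↦
        fderivWithin ℝ (v ∘ (extChartAt I c).symm) (range I) y (EuclideanSpace.basisFun _ ℝ i))
        (extChartAt I c).target := fun y hy ↦
      ((continuousWithinAt_fderivWithin v hy).mono (extChartAt_target_subset_range c)).clm_apply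
        continuousWithinAt_const
    refine (ContinuousOn.mul ?_ (hd u i)).mul (hd φ j)
    intro y hy
    have hdet : (metricCoeff g c y).det ≠ 0 := (posDef_metricCoeff g hy).det_pos.ne'
    have h1 : ContinuousAt (fun A : Matrix (Fin n) (Fin n) ℝ ↦ A⁻¹ i j) (metricCoeff g c y) := by
      simp only [Matrix.inv_def, Matrix.smul_apply, smul_eq_mul, Ring.inverse_eq_inv']
      refine ContinuousAt.mul (ContinuousAt.inv₀ ?_ hdet) ?_
      · exact (continuous_id.matrix_det).continuousAt
      · exact ((continuous_id.matrix_adjugate).matrix_elem i j).continuousAt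
    exact ContinuousAt.comp_continuousWithinAt (f := metricCoeff g c) h1
      (continuousOn_metricCoeff g c y hy)
  have h1 := (hF.comp (continuousOn_extChartAt c) (extChartAt I c).mapsTo).continuousAt
    (extChartAt_source_mem_nhds (I := I) c)
  refine h1.congr ?_
  filter_upwards [extChartAt_source_mem_nhds (I := I) c] with z hz
  simp only [Function.comp]
  rw [(extChartAt I c).left_inv hz]

end Gradient

section Volume

variable {n : ℕ} {H : Type*} [TopologicalSpace H]
  {I : ModelWithCorners ℝ (EuclideanSpace ℝ (Fin n)) H}
  {M : Type*} [TopologicalSpace M] [ChartedSpace H M] [IsManifold I ∞ M]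

/-- The density `√(det gᵢⱼ)` of the volume in the chart at `c`. -/
def density (g : SmoothMetric I M) (c : M) (y : EuclideanSpace ℝ (Fin n)) : ℝ :=
  Real.sqrt (metricCoeff g c y).det

lemma continuousOn_density (g : SmoothMetric I M) (c : M) :
    ContinuousOn (density g c) (extChartAt I c).target :=
  Real.continuous_sqrt.comp_continuousOn
    ((continuous_id.matrix_det).comp_continuousOn (continuousOn_metricCoeff g c))

lemma density_pos (g : SmoothMetric I M) {c : M} {y : EuclideanSpace ℝ (Fin n)}
    (hy : y ∈ (extChartAt I c).target) : 0 < density g c y :=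
  Real.sqrt_pos.2 (posDef_metricCoeff g hy).det_pos

lemma density_change (g : SmoothMetric I M) {c d : M} {y : EuclideanSpace ℝ (Fin n)}
    (hy : y ∈ (extChartAt I c).target) (hd : (extChartAt I c).symm y ∈ (extChartAt I d).source) :
    density g c y =
      |(fderivWithin ℝ (extChartAt I d ∘ (extChartAt I c).symm) (range I) y).det| *
        density g d (extChartAt I d ((extChartAt I c).symm y)) := by
  rw [density, density, det_metricCoeff_change g hy hd, Real.sqrt_mul (sq_nonneg _),
    Real.sqrt_sq_eq_abs]

omit [IsManifold I ∞ M] in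
lemma measurableSet_target (c : M) : MeasurableSet (extChartAt I c).target := by
  rw [extChartAt_target]
  exact ((chartAt H c).open_target.preimage I.continuous_symm).measurableSet.inter
    I.isClosed_range.measurableSet

omit [IsManifold I ∞ M] in
lemma aemeasurable_symm (c : M) :
    @AEMeasurable _ M (borel M) _ (extChartAt I c).symm
      (volume.restrict (extChartAt I c).target) := by
  let := borel M
  have : BorelSpace M := ⟨rfl⟩
  exact (continuousOn_extChartAt_symm c).aemeasurable (measurableSet_target c)

omit [IsManifold I ∞ M] in
lemma measurableSet_symm_preimage (c : M) {A : Set M} (hA : MeasurableSet[borel M] A) :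
    MeasurableSet ((extChartAt I c).symm ⁻¹' A ∩ (extChartAt I c).target) := by
  let := borel M
  have : BorelSpace M := ⟨rfl⟩
  have h := (continuousOn_iff_continuous_domRestrict.1
    (continuousOn_extChartAt_symm (I := I) c)).measurable hA
  have h2 := (MeasurableEmbedding.subtype_coe (measurableSet_target (I := I) c)).measurableSet_image.2 h
  convert h2 using 1
  ext y
  simp only [mem_inter_iff, mem_preimage, mem_image, Subtype.exists, domRestrict_apply]
  aesop

lemma chartVolume_apply (g : SmoothMetric I M) (c : M) {A : Set M}
    (hA : MeasurableSet[borel M] A) :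
    chartVolume g c A = ∫⁻ y in (extChartAt I c).symm ⁻¹' A ∩ (extChartAt I c).target,
      ENNReal.ofReal (density g c y) := by
  let := borel M
  rw [chartVolume, Measure.map_apply_of_aemeasurable
    ((aemeasurable_symm c).mono_ac (withDensity_absolutelyContinuous _ _)) hA,
    withDensity_apply', Measure.restrict_restrict' (measurableSet_target c)]
  rfl

lemma lintegral_chartVolume (g : SmoothMetric I M) (c : M) {F : M → ℝ≥0∞}
    (hF : @Measurable M _ (borel M) _ F) :
    ∫⁻ x, F x ∂(chartVolume g c) = ∫⁻ y in (extChartAt I c).target,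
      ENNReal.ofReal (density g c y) * F ((extChartAt I c).symm y) := by
  let := borel M
  rw [chartVolume, lintegral_map' hF.aemeasurable
    ((aemeasurable_symm c).mono_ac (withDensity_absolutelyContinuous _ _)),
    lintegral_withDensity_eq_lintegral_mul₀ _ _]
  · rfl
  · exact ((continuousOn_density g c).aemeasurable (measurableSet_target c)).ennreal_ofReal
  · exact hF.comp_aemeasurable (aemeasurable_symm c)

/-- The volume measures of two chart domains agree on the overlap. -/
lemma chartVolume_le (g : SmoothMetric I M) (c d : M) {A : Set M}
    (hA : MeasurableSet[borel M] A) (hAd : A ⊆ (extChartAt I d).source) :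
    chartVolume g c A ≤ chartVolume g d A := by
  set s := (extChartAt I c).symm ⁻¹' A ∩ (extChartAt I c).target with hs
  set φ := extChartAt I d ∘ (extChartAt I c).symm with hφ
  have hsm : MeasurableSet s := measurableSet_symm_preimage c hA
  have hsub : φ '' s ⊆ (extChartAt I d).symm ⁻¹' A ∩ (extChartAt I d).target := by
    rintro _ ⟨y, hy, rfl⟩
    refine ⟨?_, (extChartAt I d).map_source (hAd hy.1)⟩
    change (extChartAt I d).symm (extChartAt I d ((extChartAt I c).symm y)) ∈ A
    rw [(extChartAt I d).left_inv (hAd hy.1)]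
    exact hy.1
  have hinj : InjOn φ s := fun y hy z hz h ↦
    (extChartAt I c).symm.injOn hy.2 hz.2 ((extChartAt I d).injOn (hAd hy.1) (hAd hz.1) h)
  rw [chartVolume_apply g c hA, chartVolume_apply g d hA]
  calc ∫⁻ y in s, ENNReal.ofReal (density g c y)
      = ∫⁻ y in s, ENNReal.ofReal |(fderivWithin ℝ φ (range I) y).det| *
          ENNReal.ofReal (density g d (φ y)) := by
        refine setLIntegral_congr_fun hsm fun y hy ↦ ?_
        rw [← ENNReal.ofReal_mul (abs_nonneg _)]
        exact congrArg _ (density_change g hy.2 (hAd hy.1))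
    _ = ∫⁻ z in φ '' s, ENNReal.ofReal (density g d z) :=
        (lintegral_image_eq_lintegral_abs_det_fderiv_mul (f := φ) volume hsm (fun y hy ↦
          (coordDeriv_change hy.2 (hAd hy.1)).1.mono fun z hz ↦ mem_range_of_mem_target hz.2)
          hinj fun z ↦ ENNReal.ofReal (density g d z)).symm
    _ ≤ _ := lintegral_mono_set hsub

/-- On the domain of a chart, the volume measure is the volume measure of that chart. -/
lemma volumeMeasure_restrict_source (g : SmoothMetric I M) (d : M) :
    (volumeMeasure g).restrict (extChartAt I d).source = chartVolume g d := by
  let := borel M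
  have hB : BorelSpace M := ⟨rfl⟩
  have hS : MeasurableSet (extChartAt I d).source := (isOpen_extChartAt_source d).measurableSet
  have hle : volumeMeasure g ≤
      chartVolume g d + (⊤ : Measure M).restrict (extChartAt I d).sourceᶜ := by
    refine iSup_le fun c ↦ Measure.le_iff.2 fun A hA ↦ ?_
    rw [← measure_inter_add_sdiff A hS, Measure.add_apply,
      Measure.restrict_apply hA, ← sdiff_eq]
    refine add_le_add ((chartVolume_le g c d (hA.inter hS) inter_subset_right).trans
      (measure_mono inter_subset_left)) ?_
    exact Measure.le_iff'.1 le_top _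
  have hcs : chartVolume g d (extChartAt I d).sourceᶜ = 0 := by
    rw [chartVolume_apply g d hS.compl]
    convert setLIntegral_empty _
    ext y
    simp only [mem_inter_iff, mem_preimage, mem_compl_iff, mem_empty_iff_false, iff_false, not_and]
    exact fun h hy ↦ h ((extChartAt I d).map_target hy)
  ext A hA
  rw [Measure.restrict_apply hA]
  refine le_antisymm ?_ ?_
  · refine (Measure.le_iff'.1 hle _).trans ?_
    rw [Measure.add_apply, Measure.restrict_apply (hA.inter hS), inter_assoc, inter_compl_self,
      inter_empty, measure_empty, add_zero]
    exact measure_mono inter_subset_left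
  · rw [← measure_inter_add_sdiff A hS, measure_mono_null (s := A \ _) (fun x hx ↦ hx.2) hcs,
      add_zero]
    exact Measure.le_iff'.1 (le_iSup (chartVolume g) d) _

end Volume

section Convex

variable {E : Type*} [NormedAddCommGroup E] [NormedSpace ℝ E]

lemma sq_lintegral_le_lintegral_sq {α : Type*} [MeasurableSpace α] (μ : Measure α)
    [IsProbabilityMeasure μ] {f : α → ℝ≥0∞} (hf : AEMeasurable f μ) :
    (∫⁻ x, f x ∂μ) ^ 2 ≤ ∫⁻ x, f x ^ 2 ∂μ := by
  have h := ENNReal.lintegral_mul_le_Lp_mul_Lq μ Real.HolderConjugate.two_two hf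
    (aemeasurable_const (b := (1 : ℝ≥0∞)))
  simp only [Pi.mul_apply, mul_one, lintegral_const, measure_univ, ENNReal.rpow_two, one_pow,
    ENNReal.one_rpow] at h
  calc (∫⁻ x, f x ∂μ) ^ 2 ≤ ((∫⁻ x, f x ^ 2 ∂μ) ^ (1 / 2 : ℝ)) ^ 2 := by gcongr
    _ = ∫⁻ x, f x ^ 2 ∂μ := by
      rw [← ENNReal.rpow_natCast, ← ENNReal.rpow_mul]
      norm_num

/-- The increment of a `C¹` function along a segment in a convex set. -/
lemma enorm_sub_sq_le_lintegral_segment {B : Set E} (hB : Convex ℝ B) {v : E → ℝ}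
    {v' : E → E →L[ℝ] ℝ} (hv : ∀ y ∈ B, HasFDerivWithinAt v (v' y) B y)
    (hv' : ContinuousOn v' B) {y z : E} (hy : y ∈ B) (hz : z ∈ B) :
    ‖v y - v z‖ₑ ^ 2 ≤ ‖y - z‖ₑ ^ 2 *
      ∫⁻ t in Icc (0 : ℝ) 1, B.indicator (fun p ↦ ‖v' p‖ₑ ^ 2) (z + t • (y - z)) := by
  set γ : ℝ → E := fun t ↦ z + t • (y - z) with hγ
  have hγB : MapsTo γ (Icc 0 1) B := fun t ht ↦ hB.add_smul_sub_mem hz hy ht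
  have hγd (t : ℝ) : HasDerivAt γ (y - z) t := by
    simpa only [one_smul, id] using ((hasDerivAt_id t).smul_const (y - z)).const_add z
  have hγc : Continuous γ := by fun_prop
  have hd (t : ℝ) (ht : t ∈ Icc (0 : ℝ) 1) :
      HasDerivWithinAt (v ∘ γ) (v' (γ t) (y - z)) (Icc 0 1) t :=
    (hv _ (hγB ht)).comp_hasDerivWithinAt t (hγd t).hasDerivWithinAt hγB
  have hc : ContinuousOn (fun t ↦ v' (γ t)) (Icc 0 1) := hv'.comp hγc.continuousOn hγB
  have hc' : ContinuousOn (fun t ↦ v' (γ t) (y - z)) (Icc 0 1) := hc.clm_apply continuousOn_const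
  have h_integral : ∫ t in (0 : ℝ)..1, v' (γ t) (y - z) = v y - v z := by
    rw [intervalIntegral.integral_eq_sub_of_hasDeriv_right_of_le (f := v ∘ γ) zero_le_one
      (fun t ht ↦ (hd t ht).continuousWithinAt)
      (fun t ht ↦ ((hd t (Ioo_subset_Icc_self ht)).hasDerivAt
        (Icc_mem_nhds ht.1 ht.2)).hasDerivWithinAt)
      (hc'.intervalIntegrable_of_Icc zero_le_one)]
    simp [hγ]
  rw [intervalIntegral.integral_of_le zero_le_one, ← integral_Icc_eq_integral_Ioc] at h_integral
  have hP : IsProbabilityMeasure (volume.restrict (Icc (0 : ℝ) 1)) := ⟨by simp⟩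
  calc ‖v y - v z‖ₑ ^ 2
      ≤ (∫⁻ t in Icc (0 : ℝ) 1, ‖v' (γ t) (y - z)‖ₑ) ^ 2 := by
        rw [← h_integral]
        gcongr
        exact enorm_integral_le_lintegral_enorm _
    _ ≤ ∫⁻ t in Icc (0 : ℝ) 1, ‖v' (γ t) (y - z)‖ₑ ^ 2 :=
        sq_lintegral_le_lintegral_sq _ (hc'.aemeasurable measurableSet_Icc).enorm
    _ ≤ ∫⁻ t in Icc (0 : ℝ) 1, ‖y - z‖ₑ ^ 2 * B.indicator (fun p ↦ ‖v' p‖ₑ ^ 2) (γ t) := by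
        refine setLIntegral_mono' measurableSet_Icc fun t ht ↦ ?_
        rw [indicator_of_mem (hγB ht), ← mul_pow, mul_comm]
        gcongr
        exact (v' (γ t)).le_opENorm _
    _ = _ := lintegral_const_mul' _ _ (by finiteness)

variable [FiniteDimensional ℝ E] [MeasurableSpace E] [BorelSpace E] (ν : Measure E)
  [ν.IsAddHaarMeasure]

lemma lintegral_comp_smul_add_le {W : E → ℝ≥0∞} (hW : Measurable W) {t : ℝ} (ht : 1 / 2 ≤ t)
    (a : E) : ∫⁻ y, W (t • y + a) ∂ν ≤ 2 ^ Module.finrank ℝ E * ∫⁻ y, W y ∂ν := by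
  have ht0 : 0 < t := by linarith
  have h1 : ∫⁻ y, W (t • y + a) ∂ν = ∫⁻ y, W (y + a) ∂(Measure.map (t • ·) ν) :=
    (lintegral_map (f := fun y ↦ W (y + a)) (by fun_prop) (measurable_const_smul t)).symm
  rw [h1, Measure.map_addHaar_smul ν ht0.ne', lintegral_smul_measure, lintegral_add_right_eq_self]
  refine mul_le_mul_left ?_ _
  refine ENNReal.ofReal_le_of_le_toReal ?_
  have : (2 ^ Module.finrank ℝ E : ℝ≥0∞).toReal = 2 ^ Module.finrank ℝ E := by simp
  rw [this, abs_of_pos (by positivity), inv_le_comm₀ (by positivity) (by positivity), ← inv_pow]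
  gcongr
  linarith

/-- The Poincaré inequality on a bounded convex set. -/
lemma lintegral_enorm_sub_sq_le_of_convex {B : Set E} (hB : Convex ℝ B) (hBm : MeasurableSet B)
    {d : ℝ≥0∞} (hd' : d ≠ ⊤) (hd : ∀ y ∈ B, ∀ z ∈ B, ‖y - z‖ₑ ≤ d) {v : E → ℝ} {v' : E → E →L[ℝ] ℝ}
    (hv : ∀ y ∈ B, HasFDerivWithinAt v (v' y) B y) (hv' : ContinuousOn v' B) :
    ∫⁻ z in B, ∫⁻ y in B, ‖v y - v z‖ₑ ^ 2 ∂ν ∂ν ≤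
      d ^ 2 * (2 ^ Module.finrank ℝ E * ν B) * ∫⁻ y in B, ‖v' y‖ₑ ^ 2 ∂ν := by
  set W : E → ℝ≥0∞ := B.indicator (fun p ↦ ‖v' p‖ₑ ^ 2) with hW
  have hWm : Measurable W := by
    classical
    rw [hW, ← piecewise_eq_indicator]
    exact ((ENNReal.continuous_pow 2).comp_continuousOn hv'.enorm).measurable_piecewise
      continuousOn_const hBm
  have hWi : ∫⁻ y in B, ‖v' y‖ₑ ^ 2 ∂ν = ∫⁻ y, W y ∂ν := (lintegral_indicator hBm _).symm
  set D := ∫⁻ y, W y ∂ν with hD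
  set K : ℝ≥0∞ := 2 ^ Module.finrank ℝ E with hK
  have hslice (t : ℝ) (ht : t ∈ Icc (0 : ℝ) 1) :
      ∫⁻ z in B, ∫⁻ y in B, W (z + t • (y - z)) ∂ν ∂ν ≤ K * D * ν B := by
    rcases le_total (1 / 2) t with h | h
    · calc ∫⁻ z in B, ∫⁻ y in B, W (z + t • (y - z)) ∂ν ∂ν
          ≤ ∫⁻ z in B, K * D ∂ν := by
            refine lintegral_mono fun z ↦ (setLIntegral_le_lintegral _ _).trans ?_
            refine le_trans (le_of_eq ?_) (lintegral_comp_smul_add_le ν hWm h (z - t • z))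
            congr with y
            congr 1
            module
        _ = K * D * ν B := by simp
    · rw [lintegral_lintegral_swap (f := fun z y ↦ W (z + t • (y - z)))
        (Measurable.aemeasurable (hWm.comp (by fun_prop)))]
      calc ∫⁻ y in B, ∫⁻ z in B, W (z + t • (y - z)) ∂ν ∂ν
          ≤ ∫⁻ y in B, K * D ∂ν := by
            refine lintegral_mono fun y ↦ (setLIntegral_le_lintegral _ _).trans ?_
            refine le_trans (le_of_eq ?_)
              (lintegral_comp_smul_add_le ν hWm (t := 1 - t) (by linarith) (t • y))
            congr with z
            congr 1
            module
        _ = K * D * ν B := by simp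
  rw [hWi]
  calc ∫⁻ z in B, ∫⁻ y in B, ‖v y - v z‖ₑ ^ 2 ∂ν ∂ν
      ≤ ∫⁻ z in B, ∫⁻ y in B, d ^ 2 * (∫⁻ t in Icc (0 : ℝ) 1, W (z + t • (y - z))) ∂ν ∂ν := by
        refine setLIntegral_mono' hBm fun z hz ↦ setLIntegral_mono' hBm fun y hy ↦ ?_
        refine (enorm_sub_sq_le_lintegral_segment hB hv hv' hy hz).trans ?_
        gcongr
        exact hd y hy z hz
    _ = d ^ 2 * ∫⁻ t in Icc (0 : ℝ) 1, ∫⁻ z in B, ∫⁻ y in B, W (z + t • (y - z)) ∂ν ∂ν := by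
        simp_rw [lintegral_const_mul' (d ^ 2) _ (by finiteness)]
        congr 1
        rw [← lintegral_lintegral_swap (f := fun z t ↦ ∫⁻ y in B, W (z + t • (y - z)) ∂ν)
          (Measurable.aemeasurable (Measurable.lintegral_prod_right'
            (f := fun p : (E × ℝ) × E ↦ W (p.1.1 + p.1.2 • (p.2 - p.1.1)))
            (hWm.comp (by fun_prop))))]
        refine lintegral_congr fun z ↦ ?_
        exact lintegral_lintegral_swap (f := fun y t ↦ W (z + t • (y - z)))
          (Measurable.aemeasurable (hWm.comp (by fun_prop)))
    _ ≤ d ^ 2 * ∫⁻ t in Icc (0 : ℝ) 1, K * D * ν B := by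
        gcongr 1
        exact setLIntegral_mono' measurableSet_Icc hslice
    _ = d ^ 2 * (K * ν B) * D := by
        simp only [lintegral_const, Measure.restrict_apply_univ, Real.volume_Icc, sub_zero,
          ENNReal.ofReal_one, mul_one]
        ring

end Convex

section Gluing

variable {X ι : Type*} {mX : MeasurableSpace X} (μ : Measure X)
  {u : ι → X → ℝ} {D : ι → ℝ≥0∞}

/-- The oscillation integral `∫_U ∫_V |u x - u y|²`. -/
def oscillation (w : X → ℝ) (U V : Set X) : ℝ≥0∞ :=
  ∫⁻ x in U, ∫⁻ y in V, ‖w x - w y‖ₑ ^ 2 ∂μ ∂μ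

lemma oscillation_mono (w : X → ℝ) {U U' V V' : Set X} (hU : U ⊆ U') (hV : V ⊆ V') :
    oscillation μ w U V ≤ oscillation μ w U' V' :=
  (lintegral_mono fun _ ↦ lintegral_mono_set hV).trans (lintegral_mono_set hU)

lemma oscillation_union_le (w : X → ℝ) (hw : Measurable w) (U V V' : Set X) [SFinite μ] :
    oscillation μ w U (V ∪ V') ≤ oscillation μ w U V + oscillation μ w U V' := by
  unfold oscillation
  rw [← lintegral_add_left]
  · exact lintegral_mono fun _ ↦ lintegral_union_le _ _ _
  · refine Measurable.lintegral_prod_right' (f := fun p : X × X ↦ ‖w p.1 - w p.2‖ₑ ^ 2) ?_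
    fun_prop

lemma oscillation_comm (w : X → ℝ) (hw : Measurable w) (U V : Set X) [SFinite μ] :
    oscillation μ w U V = oscillation μ w V U := by
  unfold oscillation
  rw [lintegral_lintegral_swap]
  · simp_rw [enorm_sub_rev]
  · exact Measurable.aemeasurable (by fun_prop)

lemma measure_mul_oscillation_le (w : X → ℝ) (hw : Measurable w) (U V W : Set X) [SFinite μ] :
    μ V * oscillation μ w U W ≤
      2 * (μ W * oscillation μ w U V + μ U * oscillation μ w W V) := by
  have hsq (a b : ℝ≥0∞) : (a + b) ^ 2 ≤ 2 * (a ^ 2 + b ^ 2) := by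
    have := ENNReal.rpow_add_le_mul_rpow_add_rpow a b (p := 2) one_le_two
    norm_num at this
    simpa using this
  have hm (V : Set X) : Measurable fun x ↦ ∫⁻ y in V, ‖w x - w y‖ₑ ^ 2 ∂μ :=
    Measurable.lintegral_prod_right' (f := fun p : X × X ↦ ‖w p.1 - w p.2‖ₑ ^ 2) (by fun_prop)
  calc μ V * oscillation μ w U W
      = ∫⁻ x in U, ∫⁻ z in W, ∫⁻ y in V, ‖w x - w z‖ₑ ^ 2 ∂μ ∂μ ∂μ := by
        simp only [lintegral_const, Measure.restrict_apply_univ]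
        unfold oscillation
        rw [← lintegral_const_mul _ (hm W)]
        refine lintegral_congr fun x ↦ ?_
        rw [← lintegral_const_mul _ (by fun_prop)]
        simp_rw [mul_comm]
    _ ≤ ∫⁻ x in U, ∫⁻ z in W, ∫⁻ y in V,
          2 * (‖w x - w y‖ₑ ^ 2 + ‖w z - w y‖ₑ ^ 2) ∂μ ∂μ ∂μ := by
        refine lintegral_mono fun x ↦ lintegral_mono fun z ↦ lintegral_mono fun y ↦ ?_
        refine le_trans ?_ (hsq _ _)
        gcongr
        calc ‖w x - w z‖ₑ = ‖(w x - w y) - (w z - w y)‖ₑ := by congr 1; ring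
          _ ≤ _ := enorm_sub_le
    _ = ∫⁻ x in U, ∫⁻ z in W, 2 * (∫⁻ y in V, ‖w x - w y‖ₑ ^ 2 ∂μ +
          ∫⁻ y in V, ‖w z - w y‖ₑ ^ 2 ∂μ) ∂μ ∂μ := by
        refine lintegral_congr fun x ↦ lintegral_congr fun z ↦ ?_
        rw [lintegral_const_mul _ (by fun_prop), lintegral_add_left (by fun_prop)]
    _ = ∫⁻ x in U, 2 * (μ W * ∫⁻ y in V, ‖w x - w y‖ₑ ^ 2 ∂μ + oscillation μ w W V) ∂μ := by
        refine lintegral_congr fun x ↦ ?_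
        rw [lintegral_const_mul _ ((hm V).const_add _), lintegral_add_left measurable_const]
        simp [oscillation, mul_comm]
    _ = 2 * (μ W * oscillation μ w U V + μ U * oscillation μ w W V) := by
        rw [lintegral_const_mul _ (((hm V).const_mul _).add_const _),
          lintegral_add_left ((hm V).const_mul _), lintegral_const_mul _ (hm V)]
        simp [oscillation, mul_comm]

/-- On a connected compact space, local Poincaré inequalities imply a global one. -/
theorem exists_oscillation_le [TopologicalSpace X] [CompactSpace X] [PreconnectedSpace X]
    [IsFiniteMeasure μ] [μ.IsOpenPosMeasure] (hu : ∀ i, Measurable (u i))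
    (hloc : ∀ x, ∃ U ∈ 𝓝 x, ∃ C : ℝ≥0, ∀ i, oscillation μ (u i) U U ≤ C * D i) :
    ∃ C : ℝ≥0, ∀ i, oscillation μ (u i) univ univ ≤ C * D i := by
  have trans_aux {U V W : Set X} (hV : μ V ≠ 0) {C C' : ℝ≥0}
      (h : ∀ i, oscillation μ (u i) U V ≤ C * D i) (h' : ∀ i, oscillation μ (u i) W V ≤ C' * D i) :
      ∃ C : ℝ≥0, ∀ i, oscillation μ (u i) U W ≤ C * D i := by
    refine ⟨((μ V)⁻¹ * (2 * (μ W * C + μ U * C'))).toNNReal, fun i ↦ ?_⟩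
    rw [ENNReal.coe_toNNReal (by finiteness)]
    calc oscillation μ (u i) U W = (μ V)⁻¹ * (μ V * oscillation μ (u i) U W) := by
          rw [← mul_assoc, ENNReal.inv_mul_cancel hV (by finiteness), one_mul]
      _ ≤ (μ V)⁻¹ * (2 * (μ W * (C * D i) + μ U * (C' * D i))) := by
          gcongr (μ V)⁻¹ * ?_
          refine (measure_mul_oscillation_le μ (u i) (hu i) U V W).trans ?_
          gcongr
          · exact h i
          · exact h' i
      _ = _ := by ring
  let P (x y : X) : Prop := ∃ U ∈ 𝓝 x, ∃ V ∈ 𝓝 y, ∃ C : ℝ≥0,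
    ∀ i, oscillation μ (u i) U V ≤ C * D i
  have hP (x y : X) : P x y := by
    have hsymm : Std.Symm P := ⟨fun x y ⟨U, hU, V, hV, C, h⟩ ↦
      ⟨V, hV, U, hU, C, fun i ↦ by rw [oscillation_comm μ _ (hu i)]; exact h i⟩⟩
    refine PreconnectedSpace.induction₂ P (fun x ↦ ?_) ⟨?_⟩ x y
    · obtain ⟨U, hU, C, h⟩ := hloc x
      filter_upwards [eventually_mem_nhds_iff.2 hU] with y hy
      exact ⟨U, hU, U, hy, C, h⟩
    · rintro x y z ⟨U, hU, V, hV, C, h⟩ ⟨V', hV', W, hW, C', h'⟩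
      refine ⟨U, hU, W, hW, trans_aux (V := V ∩ V') (C := C) (C' := C')
        (Measure.measure_pos_of_mem_nhds μ (Filter.inter_mem hV hV')).ne' (fun i ↦ ?_) fun i ↦ ?_⟩
      · exact (oscillation_mono μ _ subset_rfl inter_subset_left).trans (h i)
      · rw [oscillation_comm μ _ (hu i)]
        exact (oscillation_mono μ _ inter_subset_right subset_rfl).trans (h' i)
  rcases isEmpty_or_nonempty X with hX | ⟨⟨x₀⟩⟩
  · exact ⟨0, fun i ↦ by simp [oscillation, Subsingleton.elim (univ : Set X) ∅]⟩
  obtain ⟨U, hU, C, h⟩ : ∃ U ∈ 𝓝 x₀, ∃ C : ℝ≥0, ∀ i, oscillation μ (u i) U univ ≤ C * D i := by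
    refine isCompact_univ.induction_on (p := fun S ↦ ∃ U ∈ 𝓝 x₀, ∃ C : ℝ≥0,
      ∀ i, oscillation μ (u i) U S ≤ C * D i) ?_ ?_ ?_ ?_
    · exact ⟨univ, Filter.univ_mem, 0, fun i ↦ by simp [oscillation]⟩
    · rintro S T hST ⟨U, hU, C, h⟩
      exact ⟨U, hU, C, fun i ↦ (oscillation_mono μ _ subset_rfl hST).trans (h i)⟩
    · rintro S T ⟨U, hU, C, h⟩ ⟨U', hU', C', h'⟩
      refine ⟨U ∩ U', Filter.inter_mem hU hU', C + C', fun i ↦ ?_⟩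
      rw [ENNReal.coe_add, add_mul]
      exact (oscillation_union_le μ _ (hu i) _ _ _).trans (add_le_add
        ((oscillation_mono μ _ inter_subset_left subset_rfl).trans (h i))
        ((oscillation_mono μ _ inter_subset_right subset_rfl).trans (h' i)))
    · intro y _
      obtain ⟨U, hU, V, hV, C, h⟩ := hP x₀ y
      exact ⟨V, mem_nhdsWithin_of_mem_nhds hV, U, hU, C, h⟩
  have h' (i : ι) : oscillation μ (u i) univ U ≤ C * D i := by
    rw [oscillation_comm μ _ (hu i)]
    exact h i
  exact trans_aux (Measure.measure_pos_of_mem_nhds μ hU).ne' h' h'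

end Gluing

section LocalVolume

variable {n : ℕ} {H : Type*} [TopologicalSpace H]
  {I : ModelWithCorners ℝ (EuclideanSpace ℝ (Fin n)) H}
  {M : Type*} [TopologicalSpace M] [ChartedSpace H M] [IsManifold I ∞ M]

/-- Near the centre of a chart, the metric is comparable with the Euclidean one. -/
lemma exists_ball_bounds (g : SmoothMetric I M) (c : M) :
    ∃ r > 0, ∃ m > 0, ∃ K > 0, ∀ y ∈ Metric.ball (extChartAt I c c) r ∩ range I,
      y ∈ (extChartAt I c).target ∧ m ≤ density g c y ∧ density g c y ≤ K ∧
        ‖coordForm g c y‖ ≤ K := by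
  have ht := mem_extChartAt_target (I := I) c
  have h0 := density_pos g ht
  have h1 := continuousOn_density g c _ ht
  have h2 := (continuous_norm (E := EuclideanSpace ℝ (Fin n) →L[ℝ] EuclideanSpace ℝ (Fin n) →L[ℝ] ℝ)
    ).comp_continuousOn (continuousOn_coordForm g c) _ ht
  rw [ContinuousWithinAt, nhdsWithin_extChartAt_target_eq] at h1 h2
  obtain ⟨r, hr, h⟩ := Metric.mem_nhdsWithin_iff.1 (Filter.inter_mem
    (extChartAt_target_mem_nhdsWithin (I := I) c) (Filter.inter_mem
      (h1.eventually (lt_mem_nhds (half_lt_self h0))) (Filter.inter_mem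
      (h1.eventually (gt_mem_nhds (lt_add_one _))) (h2.eventually (gt_mem_nhds (lt_add_one _))))))
  refine ⟨r, hr, _, half_pos h0, max (density g c (extChartAt I c c) + 1)
    (‖coordForm g c (extChartAt I c c)‖ + 1), lt_max_of_lt_left (by linarith), fun y hy ↦ ?_⟩
  obtain ⟨a1, a2, a3, a4⟩ := h hy
  exact ⟨a1, le_of_lt a2, le_max_of_le_left (le_of_lt a3), le_max_of_le_right (le_of_lt a4)⟩

lemma setLIntegral_volumeMeasure (g : SmoothMetric I M) (c : M) {U : Set M}
    (hU : MeasurableSet[borel M] U) (hUc : U ⊆ (extChartAt I c).source) {F : M → ℝ≥0∞}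
    (hF : @Measurable M _ (borel M) _ F) :
    ∫⁻ x in U, F x ∂(volumeMeasure g) =
      ∫⁻ y in (extChartAt I c).symm ⁻¹' U ∩ (extChartAt I c).target,
        ENNReal.ofReal (density g c y) * F ((extChartAt I c).symm y) := by
  let := borel M
  rw [← inter_eq_self_of_subset_left hUc, ← Measure.restrict_restrict hU,
    volumeMeasure_restrict_source, inter_eq_self_of_subset_left hUc, ← lintegral_indicator hU,
    lintegral_chartVolume g c (hF.indicator hU), ← lintegral_indicator (measurableSet_target c),
    ← lintegral_indicator (measurableSet_symm_preimage c hU)]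
  congr with y
  by_cases h1 : y ∈ (extChartAt I c).target <;> by_cases h2 : (extChartAt I c).symm y ∈ U <;>
    simp only [indicator, mem_inter_iff, mem_preimage, h1, h2, if_true, if_false, true_and,
      false_and, mul_zero]

/-- The preimage of a ball under the chart at `c`. -/
def chartBall (I : ModelWithCorners ℝ (EuclideanSpace ℝ (Fin n)) H) (c : M) (r : ℝ) : Set M :=
  (extChartAt I c).source ∩ extChartAt I c ⁻¹' Metric.ball (extChartAt I c c) r

omit [IsManifold I ∞ M] in
lemma isOpen_chartBall (c : M) (r : ℝ) : IsOpen (chartBall I c r) :=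
  (continuousOn_extChartAt c).isOpen_inter_preimage (isOpen_extChartAt_source c) Metric.isOpen_ball

omit [IsManifold I ∞ M] in
lemma chartBall_mem_nhds (c : M) {r : ℝ} (hr : 0 < r) : chartBall I c r ∈ 𝓝 c :=
  (isOpen_chartBall c r).mem_nhds ⟨mem_extChartAt_source c, Metric.mem_ball_self hr⟩

omit [IsManifold I ∞ M] in
lemma symm_preimage_chartBall (c : M) {r : ℝ}
    (h : ∀ y ∈ Metric.ball (extChartAt I c c) r ∩ range I, y ∈ (extChartAt I c).target) :
    (extChartAt I c).symm ⁻¹' chartBall I c r ∩ (extChartAt I c).target =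
      Metric.ball (extChartAt I c c) r ∩ range I := by
  ext y
  constructor
  · rintro ⟨⟨-, h1⟩, hy⟩
    rw [mem_preimage, (extChartAt I c).right_inv hy] at h1
    exact ⟨h1, mem_range_of_mem_target hy⟩
  · intro hy
    have hyt := h y hy
    refine ⟨⟨(extChartAt I c).map_target hyt, ?_⟩, hyt⟩
    rw [mem_preimage, (extChartAt I c).right_inv hyt]
    exact hy.1

instance isLocallyFiniteMeasure_volumeMeasure (g : SmoothMetric I M) :
    IsLocallyFiniteMeasure (volumeMeasure g) := by
  let := borel M
  have : BorelSpace M := ⟨rfl⟩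
  refine ⟨fun c ↦ ?_⟩
  obtain ⟨r, hr, m, hm, K, hK, h⟩ := exists_ball_bounds g c
  refine ⟨chartBall I c r, chartBall_mem_nhds c hr, ?_⟩
  have h1 := setLIntegral_volumeMeasure g c (isOpen_chartBall (I := I) c r).measurableSet
    inter_subset_left (measurable_const (a := 1))
  rw [setLIntegral_one, symm_preimage_chartBall c fun y hy ↦ (h y hy).1] at h1
  rw [h1]
  calc _ ≤ ∫⁻ y in Metric.ball (extChartAt I c c) r ∩ range I, ENNReal.ofReal K := by
        refine setLIntegral_mono' (measurableSet_ball.inter I.isClosed_range.measurableSet)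
          fun y hy ↦ ?_
        rw [mul_one]
        exact ENNReal.ofReal_le_ofReal (h y hy).2.2.1
    _ < _ := by
        rw [setLIntegral_const]
        exact ENNReal.mul_lt_top ENNReal.ofReal_lt_top
          ((measure_mono inter_subset_left).trans_lt measure_ball_lt_top)

instance isOpenPosMeasure_volumeMeasure (g : SmoothMetric I M) :
    (volumeMeasure g).IsOpenPosMeasure := by
  let := borel M
  have : BorelSpace M := ⟨rfl⟩
  refine ⟨fun U hU ⟨c, hc⟩ ↦ ?_⟩
  obtain ⟨r, hr, m, hm, K, hK, h⟩ := exists_ball_bounds g c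
  have hUr : IsOpen (U ∩ chartBall I c r) := hU.inter (isOpen_chartBall c r)
  refine (lt_of_lt_of_le ?_ (measure_mono (inter_subset_left (t := chartBall I c r)))).ne'
  have h1 := setLIntegral_volumeMeasure g c hUr.measurableSet
    (inter_subset_right.trans inter_subset_left) (measurable_const (a := 1))
  rw [setLIntegral_one] at h1
  rw [h1]
  set s := (extChartAt I c).symm ⁻¹' (U ∩ chartBall I c r) ∩ (extChartAt I c).target with hs
  have hsm : MeasurableSet s := measurableSet_symm_preimage c hUr.measurableSet
  have hsr : s ⊆ Metric.ball (extChartAt I c c) r ∩ range I := by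
    rw [← symm_preimage_chartBall c fun y hy ↦ (h y hy).1]
    exact inter_subset_inter_left _ (preimage_mono inter_subset_right)
  have hsn : s ∈ 𝓝[range I] (extChartAt I c c) := by
    refine Filter.inter_mem ?_ (extChartAt_target_mem_nhdsWithin c)
    exact (continuousAt_extChartAt_symm (I := I) c).continuousWithinAt.preimage_mem_nhdsWithin
      (hUr.mem_nhds (by
        rw [extChartAt_to_inv]
        exact ⟨hc, mem_of_mem_nhds (chartBall_mem_nhds c hr)⟩))
  have hspos : 0 < volume s := by
    obtain ⟨ε, hε, hεs⟩ := Metric.mem_nhdsWithin_iff.1 hsn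
    have hcl : extChartAt I c c ∈ closure (interior (range I)) :=
      I.range_subset_closure_interior (mem_range_self _)
    have hne : (Metric.ball (extChartAt I c c) ε ∩ interior (range I)).Nonempty :=
      mem_closure_iff.1 hcl _ Metric.isOpen_ball (Metric.mem_ball_self hε)
    exact ((Metric.isOpen_ball.inter isOpen_interior).measure_pos volume hne).trans_le
      (measure_mono ((inter_subset_inter_right _ interior_subset).trans hεs))
  calc 0 < ENNReal.ofReal m * volume s :=
        ENNReal.mul_pos (ENNReal.ofReal_pos.2 hm).ne' hspos.ne'
    _ = ∫⁻ y in s, ENNReal.ofReal m := (setLIntegral_const _ _).symm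
    _ ≤ _ := by
        refine setLIntegral_mono' hsm fun y hy ↦ ?_
        rw [mul_one]
        exact ENNReal.ofReal_le_ofReal (h y (hsr hy)).2.1

lemma inner_self_nonneg (g : SmoothMetric I M) (x : M) (v : TangentSpace I x) :
    0 ≤ g.inner x v v := by
  by_cases hv : v = 0
  · simp [hv]
  · exact (g.pos x v hv).le

/-- Cauchy–Schwarz for a Riemannian metric. -/
lemma inner_sq_le (g : SmoothMetric I M) (x : M) (v w : TangentSpace I x) :
    g.inner x v w ^ 2 ≤ g.inner x v v * g.inner x w w :=
  LinearMap.BilinForm.apply_sq_le_of_symm (innerForm g x).toBilinForm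
    (fun v ↦ inner_self_nonneg g x v) ⟨fun v w ↦ g.symm x v w⟩ v w

lemma norm_fderivWithin_sq_le (g : SmoothMetric I M) (u : C^∞⟮I, M; 𝓘(ℝ, ℝ), ℝ⟯) {c : M}
    {y : EuclideanSpace ℝ (Fin n)} (hy : y ∈ (extChartAt I c).target) :
    ‖fderivWithin ℝ (u ∘ (extChartAt I c).symm) (range I) y‖ ^ 2 ≤ ‖coordForm g c y‖ *
      g.inner ((extChartAt I c).symm y) (grad g u _) (grad g u _) := by
  have h0 := inner_self_nonneg g ((extChartAt I c).symm y) (grad g u _)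
  rw [← Real.le_sqrt (norm_nonneg _) (by positivity)]
  refine ContinuousLinearMap.opNorm_le_bound _ (Real.sqrt_nonneg _) fun v ↦ ?_
  rw [Real.norm_eq_abs]
  refine abs_le_of_sq_le_sq ?_ (by positivity)
  have h1 : fderivWithin ℝ (u ∘ (extChartAt I c).symm) (range I) y v =
      innerForm g ((extChartAt I c).symm y) (grad g u _) (coordDeriv I c y v) :=
    (differential_coordDeriv hy (mdifferentiableAt_smooth u _) v).symm.trans
      (inner_grad g u _ _).symm
  rw [h1, mul_pow, Real.sq_sqrt (by positivity)]
  calc _ ≤ g.inner ((extChartAt I c).symm y) (grad g u _) (grad g u _) * coordForm g c y v v :=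
        inner_sq_le g _ _ _
    _ ≤ g.inner ((extChartAt I c).symm y) (grad g u _) (grad g u _) *
          (‖coordForm g c y‖ * ‖v‖ ^ 2) := by
        gcongr
        refine (le_abs_self _).trans (((coordForm g c y).le_opNorm₂ v v).trans (le_of_eq ?_))
        ring
    _ = _ := by ring

/-- The Dirichlet energy. -/
def energy (g : SmoothMetric I M) (u : C^∞⟮I, M; 𝓘(ℝ, ℝ), ℝ⟯) : ℝ≥0∞ :=
  ∫⁻ x, ENNReal.ofReal (g.inner x (grad g u x) (grad g u x)) ∂(volumeMeasure g)

lemma exists_local_oscillation_le [CompactSpace M] (g : SmoothMetric I M) (c : M) :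
    ∃ U ∈ 𝓝 c, ∃ C : ℝ≥0, ∀ u : C^∞⟮I, M; 𝓘(ℝ, ℝ), ℝ⟯,
      oscillation (volumeMeasure g) u U U ≤ C * energy g u := by
  let := borel M
  have : BorelSpace M := ⟨rfl⟩
  obtain ⟨r, hr, m, hm, K, hK, h⟩ := exists_ball_bounds g c
  set U := chartBall I c r with hU
  have hUm : MeasurableSet U := (isOpen_chartBall (I := I) c r).measurableSet
  set B := Metric.ball (extChartAt I c c) r ∩ range I with hB
  have hUB : (extChartAt I c).symm ⁻¹' U ∩ (extChartAt I c).target = B :=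
    symm_preimage_chartBall c fun y hy ↦ (h y hy).1
  have hBm : MeasurableSet B := measurableSet_ball.inter I.isClosed_range.measurableSet
  have hBc : Convex ℝ B := (convex_ball _ _).inter I.convex_range
  have hBfin : volume B < ⊤ := (measure_mono inter_subset_left).trans_lt measure_ball_lt_top
  set d : ℝ≥0∞ := ENNReal.ofReal (r + r) with hd
  have hdB : ∀ y ∈ B, ∀ z ∈ B, ‖y - z‖ₑ ≤ d := fun y hy z hz ↦ by
    rw [← ofReal_norm, ← dist_eq_norm]
    exact ENNReal.ofReal_le_ofReal ((dist_triangle_right y z (extChartAt I c c)).trans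
      (add_le_add (Metric.mem_ball.1 hy.1).le (Metric.mem_ball.1 hz.1).le))
  set N := Module.finrank ℝ (EuclideanSpace ℝ (Fin n))
  have hm0 : ENNReal.ofReal m ≠ 0 := (ENNReal.ofReal_pos.2 hm).ne'
  refine ⟨U, chartBall_mem_nhds c hr, (ENNReal.ofReal K * ENNReal.ofReal K *
    (d ^ 2 * (2 ^ N * volume B) * (ENNReal.ofReal K * (ENNReal.ofReal m)⁻¹))).toNNReal,
    fun u ↦ ?_⟩
  rw [ENNReal.coe_toNNReal (by finiteness)]
  have hu : Measurable u := u.contMDiff.continuous.measurable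
  set v := u ∘ (extChartAt I c).symm with hv
  set v' := fderivWithin ℝ v (range I) with hv'
  have hle (F : EuclideanSpace ℝ (Fin n) → ℝ≥0∞) :
      ∫⁻ y in B, ENNReal.ofReal (density g c y) * F y ≤ ENNReal.ofReal K * ∫⁻ y in B, F y := by
    rw [← lintegral_const_mul' _ _ ENNReal.ofReal_ne_top]
    refine setLIntegral_mono' hBm fun y hy ↦ ?_
    gcongr
    exact (h y hy).2.2.1
  have hpoin := lintegral_enorm_sub_sq_le_of_convex volume hBc hBm (d := d) ENNReal.ofReal_ne_top
    hdB (v := v) (v' := v')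
    (fun y hy ↦ ((contDiffWithinAt_comp_symm u (h y hy).1).differentiableWithinAt
      (by simp)).hasFDerivWithinAt.mono inter_subset_right)
    (fun y hy ↦ (continuousWithinAt_fderivWithin u (h y hy).1).mono inter_subset_right)
  have hgrad : ∫⁻ y in B, ‖v' y‖ₑ ^ 2 ≤
      ENNReal.ofReal K * (ENNReal.ofReal m)⁻¹ * energy g u := by
    have hgm : Measurable fun x ↦ ENNReal.ofReal (g.inner x (grad g u x) (grad g u x)) :=
      (continuous_inner_grad_grad g u u).measurable.ennreal_ofReal
    have he : ∫⁻ y in B, ENNReal.ofReal (density g c y) * ENNReal.ofReal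
        (g.inner ((extChartAt I c).symm y) (grad g u _) (grad g u _)) ≤ energy g u := by
      rw [← hUB, ← setLIntegral_volumeMeasure g c hUm inter_subset_left hgm]
      exact setLIntegral_le_lintegral _ _
    refine le_trans ?_ (mul_le_mul_right he _)
    rw [← lintegral_const_mul' _ _ (by finiteness)]
    refine setLIntegral_mono' hBm fun y hy ↦ ?_
    have h1 : ‖v' y‖ₑ ^ 2 ≤ ENNReal.ofReal K * ENNReal.ofReal
        (g.inner ((extChartAt I c).symm y) (grad g u _) (grad g u _)) := by
      rw [← ofReal_norm, ← ENNReal.ofReal_pow (norm_nonneg _), ← ENNReal.ofReal_mul hK.le]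
      refine ENNReal.ofReal_le_ofReal ((norm_fderivWithin_sq_le g u (h y hy).1).trans ?_)
      exact mul_le_mul_of_nonneg_right (h y hy).2.2.2 (inner_self_nonneg g _ _)
    refine h1.trans ?_
    rw [mul_assoc]
    gcongr
    rw [← mul_assoc]
    refine le_mul_of_one_le_left zero_le ?_
    rw [← ENNReal.inv_mul_cancel hm0 ENNReal.ofReal_ne_top]
    gcongr
    exact (h y hy).2.1
  calc oscillation (volumeMeasure g) u U U
      = ∫⁻ z in B, ENNReal.ofReal (density g c z) *
          ∫⁻ y in B, ENNReal.ofReal (density g c y) * ‖v z - v y‖ₑ ^ 2 := by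
        unfold oscillation
        rw [setLIntegral_volumeMeasure g c hUm inter_subset_left, hUB]
        · congr with z
          rw [setLIntegral_volumeMeasure g c hUm inter_subset_left (by fun_prop), hUB]
          rfl
        · exact Measurable.lintegral_prod_right' (f := fun p : M × M ↦ ‖u p.1 - u p.2‖ₑ ^ 2)
            (by fun_prop)
    _ ≤ ENNReal.ofReal K * ∫⁻ z in B, ENNReal.ofReal K * ∫⁻ y in B, ‖v z - v y‖ₑ ^ 2 := by
        refine (hle _).trans ?_
        gcongr
        exact hle _
    _ = ENNReal.ofReal K * ENNReal.ofReal K * ∫⁻ z in B, ∫⁻ y in B, ‖v y - v z‖ₑ ^ 2 := by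
        rw [lintegral_const_mul' _ _ ENNReal.ofReal_ne_top, mul_assoc]
        simp_rw [enorm_sub_rev]
    _ ≤ ENNReal.ofReal K * ENNReal.ofReal K * (d ^ 2 * (2 ^ N * volume B) *
          (ENNReal.ofReal K * (ENNReal.ofReal m)⁻¹ * energy g u)) := by
        gcongr
        exact hpoin.trans (by gcongr)
    _ = _ := by ring

end LocalVolume

lemma oscillation_univ_eq {X : Type*} {mX : MeasurableSpace X} (μ : Measure X) [IsFiniteMeasure μ]
    {w : X → ℝ} (h1 : Integrable w μ) (h2 : Integrable (fun x ↦ w x ^ 2) μ) :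
    oscillation μ w univ univ = ENNReal.ofReal
      (2 * (μ.real univ * ∫ x, w x ^ 2 ∂μ - (∫ x, w x ∂μ) ^ 2)) := by
  have hsq (r : ℝ) : ‖r‖ₑ ^ 2 = ENNReal.ofReal (r ^ 2) := by
    rw [← ofReal_norm, ← ENNReal.ofReal_pow (norm_nonneg _), Real.norm_eq_abs, sq_abs]
  have h_integral (x : X) : Integrable (fun y ↦ (w x - w y) ^ 2) μ := by
    have : (fun y ↦ (w x - w y) ^ 2) = fun y ↦ w x ^ 2 - 2 * w x * w y + w y ^ 2 := by
      ext y
      ring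
    rw [this]
    exact ((integrable_const _).sub (h1.const_mul _)).add h2
  have hval (x : X) : ∫ y, (w x - w y) ^ 2 ∂μ =
      μ.real univ * w x ^ 2 - 2 * w x * (∫ y, w y ∂μ) + ∫ y, w y ^ 2 ∂μ := by
    have : (fun y ↦ (w x - w y) ^ 2) = fun y ↦ w x ^ 2 - 2 * w x * w y + w y ^ 2 := by
      ext y
      ring
    have h3 : Integrable (fun y ↦ w x ^ 2 - 2 * w x * w y) μ :=
      (integrable_const _).sub (h1.const_mul _)
    rw [this, integral_add h3 h2, integral_sub (integrable_const _) (h1.const_mul _), integral_const_mul, integral_const,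
      smul_eq_mul]
  have hinner (x : X) : ∫⁻ y, ‖w x - w y‖ₑ ^ 2 ∂μ = ENNReal.ofReal (∫ y, (w x - w y) ^ 2 ∂μ) := by
    rw [ofReal_integral_eq_lintegral_ofReal (h_integral x) (ae_of_all _ fun y ↦ sq_nonneg _)]
    simp_rw [hsq]
  have hout1 : Integrable (fun x ↦ μ.real univ * w x ^ 2 - 2 * w x * (∫ y, w y ∂μ)) μ :=
    (h2.const_mul _).sub ((h1.const_mul 2).mul_const _)
  have hout : Integrable (fun x ↦ ∫ y, (w x - w y) ^ 2 ∂μ) μ := by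
    simp_rw [hval]
    exact hout1.add (integrable_const _)
  simp only [oscillation, Measure.restrict_univ, hinner]
  rw [← ofReal_integral_eq_lintegral_ofReal hout
    (ae_of_all _ fun x ↦ integral_nonneg fun y ↦ sq_nonneg _)]
  simp_rw [hval]
  rw [integral_add hout1 (integrable_const _), integral_sub (h2.const_mul _)
    ((h1.const_mul 2).mul_const _), integral_const_mul, integral_mul_const, integral_const_mul,
    integral_const, smul_eq_mul]
  congr 1
  ring

section Spectrum

variable {n : ℕ} {H : Type*} [TopologicalSpace H]
  {I : ModelWithCorners ℝ (EuclideanSpace ℝ (Fin n)) H}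
  {M : Type*} [TopologicalSpace M] [ChartedSpace H M] [IsManifold I ∞ M]

lemma integrable_of_continuous [CompactSpace M] (g : SmoothMetric I M) {f : M → ℝ}
    (hf : Continuous f) : Integrable f (volumeMeasure g) := by
  let := borel M
  have : BorelSpace M := ⟨rfl⟩
  exact hf.integrable_of_hasCompactSupport (HasCompactSupport.of_compactSpace f)

lemma integrable_inner_grad_grad [CompactSpace M] (g : SmoothMetric I M)
    (u φ : C^∞⟮I, M; 𝓘(ℝ, ℝ), ℝ⟯) :
    Integrable (fun x ↦ g.inner x (grad g u x) (grad g φ x)) (volumeMeasure g) :=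
  integrable_of_continuous g (continuous_inner_grad_grad g u φ)

/-- The Poincaré inequality on a connected compact Riemannian manifold. -/
theorem exists_poincare [CompactSpace M] [PreconnectedSpace M] (g : SmoothMetric I M) :
    ∃ C : ℝ, 0 ≤ C ∧ ∀ u : C^∞⟮I, M; 𝓘(ℝ, ℝ), ℝ⟯,
      (volumeMeasure g).real univ * ∫ x, u x ^ 2 ∂(volumeMeasure g) -
        (∫ x, u x ∂(volumeMeasure g)) ^ 2 ≤
      C * ∫ x, g.inner x (grad g u x) (grad g u x) ∂(volumeMeasure g) := by
  let := borel M
  have : BorelSpace M := ⟨rfl⟩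
  obtain ⟨C, hC⟩ := exists_oscillation_le (volumeMeasure g)
    (u := fun (u : C^∞⟮I, M; 𝓘(ℝ, ℝ), ℝ⟯) (x : M) ↦ u x) (D := energy g)
    (fun u ↦ u.contMDiff.continuous.measurable) (exists_local_oscillation_le g)
  refine ⟨C, C.coe_nonneg, fun u ↦ ?_⟩
  have h := hC u
  have hu : Continuous u := u.contMDiff.continuous
  have hE : 0 ≤ ∫ x, g.inner x (grad g u x) (grad g u x) ∂(volumeMeasure g) :=
    integral_nonneg fun x ↦ inner_self_nonneg g x _
  rw [oscillation_univ_eq _ (integrable_of_continuous g hu)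
    (integrable_of_continuous g (hu.pow 2)), energy,
    ← ofReal_integral_eq_lintegral_ofReal (integrable_inner_grad_grad g u u)
      (ae_of_all _ fun x ↦ inner_self_nonneg g x _), ← ENNReal.ofReal_coe_nnreal,
    ← ENNReal.ofReal_mul C.coe_nonneg, ENNReal.ofReal_le_ofReal_iff (mul_nonneg C.coe_nonneg hE)] at h
  have := mul_nonneg C.coe_nonneg hE
  linarith

omit [IsManifold I ∞ M] in
lemma differential_const (r : ℝ) (x : M) : differential I (fun _ : M ↦ r) x = 0 :=
  mfderiv_const

lemma inner_grad_const (g : SmoothMetric I M) (u : M → ℝ) (r : ℝ) (x : M) :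
    g.inner x (grad g u x) (grad g (fun _ ↦ r) x) = 0 := by
  rw [g.symm, inner_grad, differential_const]
  rfl

lemma eq_zero_of_integral_sq_nonpos [CompactSpace M] (g : SmoothMetric I M) {f : M → ℝ}
    (hf : Continuous f) (h : ∫ x, f x ^ 2 ∂(volumeMeasure g) ≤ 0) : f = 0 := by
  let := borel M
  have : BorelSpace M := ⟨rfl⟩
  have h0 : ∫ x, f x ^ 2 ∂(volumeMeasure g) = 0 :=
    le_antisymm h (integral_nonneg fun x ↦ sq_nonneg _)
  rw [integral_eq_zero_iff_of_nonneg (fun x ↦ sq_nonneg _)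
    (integrable_of_continuous g (hf.pow 2))] at h0
  have h1 := (Continuous.ae_eq_iff_eq (volumeMeasure g) (hf.pow 2) continuous_const).1 h0
  ext x
  exact pow_eq_zero_iff two_ne_zero |>.1 (congrFun h1 x)

lemma volumeMeasure_real_univ_pos [CompactSpace M] [Nonempty M] (g : SmoothMetric I M) :
    0 < (volumeMeasure g).real univ := by
  let := borel M
  have : BorelSpace M := ⟨rfl⟩
  exact ENNReal.toReal_pos (isOpen_univ.measure_ne_zero _ univ_nonempty) (by finiteness)

/-- On a connected manifold, small eigenvalues have only constant eigenfunctions. -/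
theorem exists_spectralSpace_le_span_one [CompactSpace M] [ConnectedSpace M]
    (g : SmoothMetric I M) : ∃ L : ℝ≥0, 0 < L ∧ spectralSpace g L ≤ Submodule.span ℝ {1} := by
  let := borel M
  have : BorelSpace M := ⟨rfl⟩
  obtain ⟨C, hC0, hC⟩ := exists_poincare g
  set V := (volumeMeasure g).real univ with hV
  have hV0 : 0 < V := volumeMeasure_real_univ_pos g
  have hL : 0 < V / (2 * (C + 1)) := by positivity
  refine ⟨⟨V / (2 * (C + 1)), hL.le⟩, hL, Submodule.span_le.2 ?_⟩
  rintro u ⟨μ, hμ, hu⟩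
  have hμ' : μ ≤ V / (2 * (C + 1)) := hμ
  rw [le_div_iff₀ (by positivity)] at hμ'
  have huc : Continuous u := u.contMDiff.continuous
  have hE := hu u
  have h1 := hu 1
  have hP := hC u
  simp only [ContMDiffMap.coe_one, Pi.one_apply, mul_one] at h1
  have hone (x : M) : g.inner x (grad g u x) (grad g 1 x) = 0 := inner_grad_const g u 1 x
  simp_rw [hone, integral_zero] at h1
  simp_rw [← pow_two] at hE
  rw [hE] at hP
  set S := ∫ x, u x ^ 2 ∂(volumeMeasure g) with hS
  set m := ∫ x, u x ∂(volumeMeasure g) with hm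
  have hS0 : 0 ≤ S := integral_nonneg fun x ↦ sq_nonneg _
  suffices h : ∃ a : ℝ, ∫ x, (u x - a) ^ 2 ∂(volumeMeasure g) ≤ 0 by
    obtain ⟨a, ha⟩ := h
    have h2 := eq_zero_of_integral_sq_nonpos g (huc.sub continuous_const) ha
    refine Submodule.mem_span_singleton.2 ⟨a, ?_⟩
    ext x
    have h3 : u x - a = 0 := congrFun h2 x
    change a * 1 = u x
    linarith
  by_cases hμ0 : μ = 0
  · refine ⟨m / V, ?_⟩
    have hexp : ∫ x, (u x - m / V) ^ 2 ∂(volumeMeasure g) = S - m ^ 2 / V := by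
      have : (fun x ↦ (u x - m / V) ^ 2) =
          fun x ↦ u x ^ 2 - 2 * (m / V) * u x + (m / V) ^ 2 := by
        ext x
        ring
      have i1 : Integrable (fun x ↦ u x ^ 2) (volumeMeasure g) :=
        integrable_of_continuous g (huc.pow 2)
      have i2 := (integrable_of_continuous g huc).const_mul (2 * (m / V))
      have i3 : Integrable (fun x ↦ u x ^ 2 - 2 * (m / V) * u x) (volumeMeasure g) := i1.sub i2
      rw [this, integral_add i3 (integrable_const _), integral_sub i1 i2,
        integral_const_mul, integral_const, smul_eq_mul, ← hS, ← hm, ← hV]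
      field_simp
      ring
    rw [hexp, sub_nonpos, le_div_iff₀ hV0]
    rw [hμ0] at hP
    linarith
  · have hm0 : m = 0 := by
      rcases mul_eq_zero.1 h1.symm with h | h
      · exact absurd h hμ0
      · exact h
    refine ⟨0, ?_⟩
    simp only [sub_zero]
    rw [hm0] at hP
    by_contra! hSpos
    have h3 : V ≤ C * μ := by
      have : S * V ≤ S * (C * μ) := by nlinarith
      exact le_of_mul_le_mul_left this hSpos
    nlinarith

end Spectrum

section Sigma

variable {n : ℕ} {H : Type*} [TopologicalSpace H] [Nonempty H]
  {I : ModelWithCorners ℝ (EuclideanSpace ℝ (Fin n)) H}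
  {ι : Type} {M : ι → Type*} [∀ i, TopologicalSpace (M i)]
  [∀ i, ChartedSpace H (M i)]

lemma hasMFDerivAt_sigmaMk (i : ι) (x : M i) : HasMFDerivAt I I (Sigma.mk i : M i → Σ i, M i) x
    (ContinuousLinearMap.id ℝ (EuclideanSpace ℝ (Fin n))) := by
  refine ⟨continuous_sigmaMk.continuousAt, ?_⟩
  refine (hasFDerivWithinAt_id _ _).congr_of_eventuallyEq ?_ ?_
  · filter_upwards [extChartAt_target_mem_nhdsWithin (I := I) x] with y hy
    exact (extChartAt_sigma_apply i x _).trans ((extChartAt I x).right_inv hy)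
  · exact (extChartAt_sigma_apply i x _).trans
      ((extChartAt I x).right_inv (mem_extChartAt_target x))

lemma contMDiffAt_comp_sigmaMk {i : ι} {x : M i} {f : (Σ i, M i) → ℝ}
    (h : ContMDiffAt I 𝓘(ℝ, ℝ) ∞ f ⟨i, x⟩) : ContMDiffAt I 𝓘(ℝ, ℝ) ∞ (fun y ↦ f ⟨i, y⟩) x := by
  rw [contMDiffAt_iff] at h ⊢
  refine ⟨h.1.comp continuous_sigmaMk.continuousAt, ?_⟩
  have h2 := h.2
  rw [extChartAt_sigma_apply] at h2
  exact h2

/-- A smooth function on a disjoint union is a family of smooth functions. -/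
def restrictEquiv (I : ModelWithCorners ℝ (EuclideanSpace ℝ (Fin n)) H) (M : ι → Type*)
    [∀ i, TopologicalSpace (M i)] [∀ i, ChartedSpace H (M i)] :
    C^∞⟮I, Σ i, M i; 𝓘(ℝ, ℝ), ℝ⟯ ≃ₗ[ℝ] ∀ i, C^∞⟮I, M i; 𝓘(ℝ, ℝ), ℝ⟯ where
  toFun u i := ⟨fun x ↦ u ⟨i, x⟩, fun x ↦ contMDiffAt_comp_sigmaMk (u.contMDiff ⟨i, x⟩)⟩
  map_add' _ _ := rfl
  map_smul' _ _ := rfl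
  invFun f := ⟨fun p ↦ f p.1 p.2, fun p ↦ contMDiffAt_sigma ((f p.1).contMDiff p.2)⟩
  left_inv _ := rfl
  right_inv _ := rfl

variable [∀ i, IsManifold I ∞ (M i)]

lemma coordDeriv_sigma (i : ι) (x : M i) {y : EuclideanSpace ℝ (Fin n)}
    (hy : y ∈ (extChartAt I x).target) :
    coordDeriv I (⟨i, x⟩ : Σ i, M i) y = coordDeriv I x y := by
  have h := mfderiv_comp_mfderivWithin (I := 𝓘(ℝ, EuclideanSpace ℝ (Fin n))) (I' := I)
    (I'' := I) (x := y) (s := range I) (g := (Sigma.mk i : M i → Σ i, M i))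
    (hasMFDerivAt_sigmaMk i _).mdifferentiableAt (mdifferentiableWithinAt_symm hy)
    (I.uniqueMDiffOn y (mem_range_of_mem_target hy))
  rw [(hasMFDerivAt_sigmaMk i _).mfderiv] at h
  exact h.trans (ContinuousLinearMap.id_comp _)

lemma metricCoeff_sigma (g : ∀ i, SmoothMetric I (M i)) (i : ι) (x : M i)
    {y : EuclideanSpace ℝ (Fin n)} (hy : y ∈ (extChartAt I x).target) :
    metricCoeff (sigmaMetric g) ⟨i, x⟩ y = metricCoeff (g i) x y := by
  rw [metricCoeff_eq_toMatrix, metricCoeff_eq_toMatrix]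
  congr 2
  unfold coordForm
  rw [coordDeriv_sigma i x hy]
  rfl

lemma density_sigma (g : ∀ i, SmoothMetric I (M i)) (i : ι) (x : M i)
    {y : EuclideanSpace ℝ (Fin n)} (hy : y ∈ (extChartAt I x).target) :
    density (sigmaMetric g) ⟨i, x⟩ y = density (g i) x y :=
  congrArg (fun A ↦ Real.sqrt (Matrix.det A)) (metricCoeff_sigma g i x hy)

lemma chartVolume_sigma (g : ∀ i, SmoothMetric I (M i)) (i : ι) (x : M i) :
    chartVolume (sigmaMetric g) ⟨i, x⟩ =
      @Measure.map _ _ (borel (M i)) (borel (Σ i, M i)) (Sigma.mk i) (chartVolume (g i) x) := by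
  let := fun i ↦ borel (M i)
  have (i : ι) : BorelSpace (M i) := ⟨rfl⟩
  let : MeasurableSpace (Σ i, M i) := borel _
  have : BorelSpace (Σ i, M i) := ⟨rfl⟩
  refine Measure.ext fun A hA ↦ ?_
  have hmk : Measurable (Sigma.mk i : M i → Σ i, M i) := continuous_sigmaMk.measurable
  have hset : (extChartAt I (⟨i, x⟩ : Σ i, M i)).symm ⁻¹' A ∩
      (extChartAt I (⟨i, x⟩ : Σ i, M i)).target =
      (extChartAt I x).symm ⁻¹' (Sigma.mk i ⁻¹' A) ∩ (extChartAt I x).target := rfl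
  rw [Measure.map_apply hmk hA, chartVolume_apply _ _ hA, chartVolume_apply _ _ (hmk hA), hset]
  refine setLIntegral_congr_fun (measurableSet_symm_preimage x (hmk hA)) fun y hy ↦ ?_
  rw [density_sigma g i x hy.2]

/-- The volume measure of a disjoint union. -/
lemma volumeMeasure_sigma [Fintype ι] (g : ∀ i, SmoothMetric I (M i)) :
    volumeMeasure (sigmaMetric g) = ∑ i,
      @Measure.map _ _ (borel (M i)) (borel (Σ i, M i)) (Sigma.mk i) (volumeMeasure (g i)) := by
  let := fun i ↦ borel (M i)
  have (i : ι) : BorelSpace (M i) := ⟨rfl⟩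
  let : MeasurableSpace (Σ i, M i) := borel _
  have : BorelSpace (Σ i, M i) := ⟨rfl⟩
  have hmk (i : ι) : MeasurableEmbedding (Sigma.mk i : M i → Σ i, M i) :=
    Topology.IsOpenEmbedding.sigmaMk.measurableEmbedding
  refine le_antisymm (iSup_le ?_) ?_
  · rintro ⟨i, x⟩
    rw [chartVolume_sigma]
    refine (Measure.map_mono (le_iSup (chartVolume (g i)) x) (hmk i).measurable).trans ?_
    exact Finset.single_le_sum (f := fun i ↦ Measure.map (Sigma.mk i) (volumeMeasure (g i)))
      (fun _ _ ↦ Measure.zero_le _) (Finset.mem_univ i)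
  · have hle (i : ι) : volumeMeasure (g i) ≤
        (volumeMeasure (sigmaMetric g)).comap (Sigma.mk i) := by
      refine iSup_le fun x ↦ ?_
      have h1 : Measure.map (Sigma.mk i) (chartVolume (g i) x) ≤ volumeMeasure (sigmaMetric g) := by
        rw [← chartVolume_sigma]
        exact le_iSup (chartVolume (sigmaMetric g)) _
      refine Measure.le_iff.2 fun A hA ↦ ?_
      rw [(hmk i).comap_apply, ← preimage_image_eq A (hmk i).injective,
        ← (hmk i).map_apply, preimage_image_eq A (hmk i).injective]
      exact Measure.le_iff'.1 h1 _
    refine Measure.le_iff.2 fun A hA ↦ ?_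
    rw [Measure.finsetSum_apply]
    calc ∑ i, Measure.map (Sigma.mk i) (volumeMeasure (g i)) A
        ≤ ∑ i, volumeMeasure (sigmaMetric g) (A ∩ range (Sigma.mk i)) := by
          refine Finset.sum_le_sum fun i _ ↦ ?_
          rw [(hmk i).map_apply, ← image_preimage_eq_inter_range, ← (hmk i).comap_apply]
          exact Measure.le_iff'.1 (hle i) _
      _ = volumeMeasure (sigmaMetric g) (⋃ i, A ∩ range (Sigma.mk i)) := by
          rw [measure_iUnion, tsum_fintype]
          · intro i j hij
            refine disjoint_left.2 ?_
            rintro _ ⟨-, x, rfl⟩ ⟨-, y, hy⟩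
            exact hij (congrArg Sigma.fst hy).symm
          · exact fun i ↦ hA.inter (hmk i).measurableSet_range
      _ ≤ _ := measure_mono (iUnion_subset fun i ↦ inter_subset_left)

lemma vol_sigma [Fintype ι] (g : ∀ i, SmoothMetric I (M i)) :
    vol (sigmaMetric g) = ∑ i, vol (g i) := by
  let := fun i ↦ borel (M i)
  have (i : ι) : BorelSpace (M i) := ⟨rfl⟩
  let : MeasurableSpace (Σ i, M i) := borel _
  have : BorelSpace (Σ i, M i) := ⟨rfl⟩
  rw [vol, volumeMeasure_sigma, Measure.finsetSum_apply]
  exact Finset.sum_congr rfl fun i _ ↦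
    Measure.map_apply continuous_sigmaMk.measurable MeasurableSet.univ

lemma integral_sigma [Fintype ι] [∀ i, CompactSpace (M i)] (g : ∀ i, SmoothMetric I (M i))
    {f : (Σ i, M i) → ℝ} (hf : ∀ i, Continuous fun x : M i ↦ f ⟨i, x⟩) :
    ∫ p, f p ∂(volumeMeasure (sigmaMetric g)) = ∑ i, ∫ x, f ⟨i, x⟩ ∂(volumeMeasure (g i)) := by
  let := fun i ↦ borel (M i)
  have (i : ι) : BorelSpace (M i) := ⟨rfl⟩
  let : MeasurableSpace (Σ i, M i) := borel _
  have : BorelSpace (Σ i, M i) := ⟨rfl⟩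
  have hmk (i : ι) : MeasurableEmbedding (Sigma.mk i : M i → Σ i, M i) :=
    Topology.IsOpenEmbedding.sigmaMk.measurableEmbedding
  rw [volumeMeasure_sigma, integral_finsetSum_measure]
  · exact Finset.sum_congr rfl fun i _ ↦ (hmk i).integral_map _
  · exact fun i _ ↦ (hmk i).integrable_map_iff.2 (integrable_of_continuous (g i) (hf i))

omit [∀ i, IsManifold I ∞ (M i)] in
lemma differential_sigma (u : C^∞⟮I, Σ i, M i; 𝓘(ℝ, ℝ), ℝ⟯) (i : ι) (x : M i) :
    differential I u ⟨i, x⟩ = differential I (restrictEquiv I M u i) x := by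
  have h := (mdifferentiableAt_smooth u ⟨i, x⟩).hasMFDerivAt.comp x (hasMFDerivAt_sigmaMk i x)
  have h2 := h.mfderiv
  exact ((ContinuousLinearMap.comp_id _).symm.trans h2.symm : _)

lemma grad_sigma (g : ∀ i, SmoothMetric I (M i)) (u : C^∞⟮I, Σ i, M i; 𝓘(ℝ, ℝ), ℝ⟯) (i : ι)
    (x : M i) : grad (sigmaMetric g) u ⟨i, x⟩ = grad (g i) (restrictEquiv I M u i) x := by
  unfold grad
  rw [differential_sigma]
  rfl

variable [Fintype ι] [∀ i, CompactSpace (M i)]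

lemma integral_inner_grad_sigma (g : ∀ i, SmoothMetric I (M i))
    (u φ : C^∞⟮I, Σ i, M i; 𝓘(ℝ, ℝ), ℝ⟯) :
    ∫ p, (sigmaMetric g).inner p (grad (sigmaMetric g) u p) (grad (sigmaMetric g) φ p)
      ∂(volumeMeasure (sigmaMetric g)) =
    ∑ i, ∫ x, (g i).inner x (grad (g i) (restrictEquiv I M u i) x)
      (grad (g i) (restrictEquiv I M φ i) x) ∂(volumeMeasure (g i)) := by
  have h (i : ι) (x : M i) : (sigmaMetric g).inner ⟨i, x⟩ (grad (sigmaMetric g) u ⟨i, x⟩)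
      (grad (sigmaMetric g) φ ⟨i, x⟩) = (g i).inner x (grad (g i) (restrictEquiv I M u i) x)
      (grad (g i) (restrictEquiv I M φ i) x) := by
    rw [grad_sigma, grad_sigma]
    rfl
  rw [integral_sigma]
  · simp_rw [h]
  · intro i
    simp_rw [h]
    exact continuous_inner_grad_grad _ _ _

lemma integral_mul_sigma (g : ∀ i, SmoothMetric I (M i))
    (u φ : C^∞⟮I, Σ i, M i; 𝓘(ℝ, ℝ), ℝ⟯) :
    ∫ p, u p * φ p ∂(volumeMeasure (sigmaMetric g)) =
    ∑ i, ∫ x, restrictEquiv I M u i x * restrictEquiv I M φ i x ∂(volumeMeasure (g i)) :=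
  integral_sigma g fun i ↦ ((restrictEquiv I M u i).contMDiff.continuous.mul
    (restrictEquiv I M φ i).contMDiff.continuous)

omit [Nonempty H] [∀ i, CompactSpace (M i)] [Fintype ι] in
lemma grad_zero {i : ι} (g : SmoothMetric I (M i)) (x : M i) :
    grad g (0 : M i → ℝ) x = 0 := by
  have : differential I (0 : M i → ℝ) x = 0 := differential_const 0 x
  simp [grad, this]

omit [Nonempty H] [∀ i, CompactSpace (M i)] [Fintype ι] in
lemma isNeumannSolution_zero {i : ι} (g : SmoothMetric I (M i)) (μ : ℝ) :
    IsNeumannSolution g μ 0 := by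
  intro φ
  simp [grad_zero]

/-- The Neumann problem on a disjoint union decouples. -/
lemma isNeumannSolution_sigma_iff (g : ∀ i, SmoothMetric I (M i)) (μ : ℝ)
    (u : C^∞⟮I, Σ i, M i; 𝓘(ℝ, ℝ), ℝ⟯) :
    IsNeumannSolution (sigmaMetric g) μ u ↔
      ∀ i, IsNeumannSolution (g i) μ (restrictEquiv I M u i) := by
  classical
  constructor
  · intro h i φ
    have h1 := h ((restrictEquiv I M).symm (Pi.single i φ))
    rw [integral_inner_grad_sigma, integral_mul_sigma, LinearEquiv.apply_symm_apply,
      Finset.sum_eq_single i, Finset.sum_eq_single i, Pi.single_eq_same] at h1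
    · exact h1
    · intro j _ hj
      simp [Pi.single_eq_of_ne hj]
    · simp
    · intro j _ hj
      simp [Pi.single_eq_of_ne hj, grad_zero]
    · simp
  · intro h φ
    rw [integral_inner_grad_sigma, integral_mul_sigma, Finset.mul_sum]
    exact Finset.sum_congr rfl fun i _ ↦ h i _

lemma map_spectralSpace_sigma (g : ∀ i, SmoothMetric I (M i)) (L : ℝ) :
    (spectralSpace (sigmaMetric g) L).map (restrictEquiv I M).toLinearMap =
      Submodule.pi univ fun i ↦ spectralSpace (g i) L := by
  classical
  refine le_antisymm ?_ fun f hf ↦ ?_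
  · rw [Submodule.map_le_iff_le_comap]
    refine Submodule.span_le.2 ?_
    rintro u ⟨μ, hμ, hu⟩
    exact fun i _ ↦ Submodule.subset_span ⟨μ, hμ, (isNeumannSolution_sigma_iff g μ u).1 hu i⟩
  · rw [← Finset.univ_sum_single f]
    refine Submodule.sum_mem _ fun i _ ↦ ?_
    have hi : spectralSpace (g i) L ≤ ((spectralSpace (sigmaMetric g) L).map
        (restrictEquiv I M).toLinearMap).comap (LinearMap.single ℝ _ i) := by
      refine Submodule.span_le.2 ?_
      rintro v ⟨μ, hμ, hv⟩
      refine ⟨(restrictEquiv I M).symm (Pi.single i v), Submodule.subset_span ⟨μ, hμ, ?_⟩, ?_⟩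
      · rw [isNeumannSolution_sigma_iff, LinearEquiv.apply_symm_apply]
        intro j
        rcases eq_or_ne j i with rfl | hj
        · rwa [Pi.single_eq_same]
        · rw [Pi.single_eq_of_ne hj]
          exact isNeumannSolution_zero _ _
      · exact LinearEquiv.apply_symm_apply _ _
    exact hi (hf i trivial)

/-- The number of eigenvalues in `[0, L]`, counted with multiplicity. -/
def spectralCount {X : Type*} [TopologicalSpace X] [ChartedSpace H X] [IsManifold I ∞ X]
    (g : SmoothMetric I X) (L : ℝ) : ℕ∞ :=
  Cardinal.toENat (Module.rank ℝ (spectralSpace g L))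

lemma toENat_sum {ι : Type} [Fintype ι] (f : ι → Cardinal.{u}) :
    Cardinal.toENat (Cardinal.sum f) = ∑ i, Cardinal.toENat (f i) := by
  by_cases h : ∃ i, Cardinal.aleph0 ≤ f i
  · obtain ⟨i, hi⟩ := h
    have h1 : Cardinal.toENat (Cardinal.sum f) = ⊤ :=
      Cardinal.toENat_eq_top.2 (hi.trans (by simpa using Cardinal.le_sum f i))
    rw [h1]
    refine (top_le_iff.1 ?_).symm
    rw [← Cardinal.toENat_eq_top.2 hi]
    exact Finset.single_le_sum (f := fun i ↦ Cardinal.toENat (f i)) (fun _ _ ↦ zero_le)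
      (Finset.mem_univ i)
  · push Not at h
    choose m hm using fun i ↦ Cardinal.lt_aleph0.1 (h i)
    have hf : f = fun i ↦ Cardinal.mk (ULift.{u} (Fin (m i))) := by
      ext i
      simp [hm]
    have h1 : Cardinal.toENat (Cardinal.sum f) = ENat.card (Σ i, ULift.{u} (Fin (m i))) := by
      rw [hf, ← Cardinal.mk_sigma]
      rfl
    rw [h1, ENat.card_eq_coe_fintype_card, Fintype.card_sigma]
    simp [hm]

/-- Counting eigenvalues is additive over disjoint unions. -/
lemma spectralCount_sigma (g : ∀ i, SmoothMetric I (M i)) (L : ℝ) :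
    spectralCount (sigmaMetric g) L = ∑ i, spectralCount (g i) L := by
  let f : (∀ i, spectralSpace (g i) L) →ₗ[ℝ] ∀ i, C^∞⟮I, M i; 𝓘(ℝ, ℝ), ℝ⟯ :=
    LinearMap.pi fun i ↦ (spectralSpace (g i) L).subtype ∘ₗ LinearMap.proj i
  have hf : Function.Injective f := fun a b h ↦ funext fun i ↦ Subtype.ext (congrFun h i)
  have hr : LinearMap.range f = Submodule.pi univ fun i ↦ spectralSpace (g i) L := by
    ext a
    constructor
    · rintro ⟨b, rfl⟩ i -
      exact (b i).2
    · exact fun ha ↦ ⟨fun i ↦ ⟨a i, ha i trivial⟩, rfl⟩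
  have h1 := LinearEquiv.rank_eq
    ((restrictEquiv I M).submoduleMap (spectralSpace (sigmaMetric g) L))
  unfold spectralCount
  rw [h1, ← toENat_sum, ← rank_pi, ← rank_range_of_injective f hf, hr]
  erw [map_spectralSpace_sigma]

end Sigma

section Conformal

variable {n : ℕ} {H : Type*} [TopologicalSpace H]
  {I : ModelWithCorners ℝ (EuclideanSpace ℝ (Fin n)) H}
  {M : Type*} [TopologicalSpace M] [ChartedSpace H M] [IsManifold I ∞ M]

/-- The conformal metric `e^{2f} g`. -/
def conformalMetric (f : C^∞⟮I, M; 𝓘(ℝ, ℝ), ℝ⟯) (g : SmoothMetric I M) : SmoothMetric I M where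
  inner x := Real.exp (2 * f x) • g.inner x
  symm x v w := by
    change Real.exp (2 * f x) * g.inner x v w = Real.exp (2 * f x) * g.inner x w v
    rw [g.symm]
  pos x v hv := mul_pos (Real.exp_pos _) (g.pos x v hv)
  isVonNBounded x := by
    refine ((g.isVonNBounded x).image
      (Real.exp (-f x) • ContinuousLinearMap.id ℝ (TangentSpace I x))).subset fun v hv ↦ ?_
    refine ⟨Real.exp (f x) • v, ?_, ?_⟩
    · have hv' : Real.exp (2 * f x) * g.inner x v v < 1 := hv
      change g.inner x (Real.exp (f x) • v) (Real.exp (f x) • v) < 1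
      rw [map_smul, map_smul]
      change Real.exp (f x) * (Real.exp (f x) * g.inner x v v) < 1
      rwa [← mul_assoc, ← Real.exp_add, ← two_mul]
    · change Real.exp (-f x) • Real.exp (f x) • v = v
      rw [smul_smul, ← Real.exp_add, neg_add_cancel, Real.exp_zero, one_smul]
  contMDiff := by
    have hf : ContMDiff I 𝓘(ℝ, ℝ) ∞ fun x ↦ Real.exp (2 * f x) :=
      (Real.contDiff_exp.contMDiff).comp (contMDiff_const.mul f.contMDiff)
    exact hf.smul_section g.contMDiff

lemma conformalMetric_mem (f : C^∞⟮I, M; 𝓘(ℝ, ℝ), ℝ⟯) (g : SmoothMetric I M) :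
    conformalMetric f g ∈ conformalClass g :=
  ⟨f, fun _ _ _ ↦ rfl⟩

lemma self_mem_conformalClass (g : SmoothMetric I M) : g ∈ conformalClass g :=
  ⟨0, fun _ _ _ ↦ by simp⟩

lemma metric_ext {g h : SmoothMetric I M} (H : ∀ x v w, g.inner x v w = h.inner x v w) : g = h := by
  have : g.inner = h.inner := by
    ext x v w
    exact H x v w
  cases g
  cases h
  congr

lemma exists_homothetic_mem_conformalClass {g h : SmoothMetric I M} (hh : h ∈ conformalClass g)
    {r : ℝ} (hr : 0 < r) :
    ∃ h' ∈ conformalClass g, ∀ x v w, h'.inner x v w = r * h.inner x v w := by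
  obtain ⟨f, hf⟩ := hh
  let c : C^∞⟮I, M; 𝓘(ℝ, ℝ), ℝ⟯ := ⟨fun _ ↦ Real.log r / 2, contMDiff_const⟩
  refine ⟨conformalMetric (f + c) g, conformalMetric_mem _ _, fun x v w ↦ ?_⟩
  change Real.exp (2 * (f x + Real.log r / 2)) * g.inner x v w = _
  rw [hf, mul_add, Real.exp_add, mul_div_cancel₀ _ two_ne_zero, Real.exp_log hr]
  ring

section Scaling

variable {g h : SmoothMetric I M} {r : ℝ} (hr : 0 < r)
  (hgh : ∀ x v w, h.inner x v w = r * g.inner x v w)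

include hr hgh

lemma density_homothetic (c : M) (y : EuclideanSpace ℝ (Fin n)) :
    density h c y = r ^ (n / 2 : ℝ) * density g c y := by
  have : metricCoeff h c y = r • metricCoeff g c y := by
    ext i j
    exact hgh _ _ _
  rw [density, this, Matrix.det_smul, Fintype.card_fin, Real.sqrt_mul (by positivity), density,
    Real.sqrt_eq_rpow (r ^ n), ← Real.rpow_natCast, ← Real.rpow_mul hr.le]
  congr 2
  ring

lemma chartVolume_homothetic (c : M) :
    chartVolume h c = ENNReal.ofReal (r ^ (n / 2 : ℝ)) • chartVolume g c := by
  let := borel M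
  refine Measure.ext fun A hA ↦ ?_
  rw [Measure.smul_apply, chartVolume_apply _ _ hA, chartVolume_apply _ _ hA, smul_eq_mul,
    ← lintegral_const_mul' _ _ ENNReal.ofReal_ne_top]
  refine lintegral_congr fun y ↦ ?_
  rw [density_homothetic hr hgh, ENNReal.ofReal_mul (by positivity)]

lemma volumeMeasure_homothetic :
    volumeMeasure h = ENNReal.ofReal (r ^ (n / 2 : ℝ)) • volumeMeasure g := by
  let := borel M
  set a := ENNReal.ofReal (r ^ (n / 2 : ℝ)) with ha
  have ha0 : a ≠ 0 := (ENNReal.ofReal_pos.2 (by positivity)).ne'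
  have hat : a ≠ ⊤ := ENNReal.ofReal_ne_top
  have hmono (b : ℝ≥0∞) {μ ν : Measure M} (hμν : μ ≤ ν) : b • μ ≤ b • ν :=
    Measure.le_iff'.2 fun s ↦ mul_le_mul_right (Measure.le_iff'.1 hμν s) b
  refine le_antisymm (iSup_le fun c ↦ ?_) ?_
  · rw [chartVolume_homothetic hr hgh]
    exact hmono _ (le_iSup (chartVolume g) c)
  · have h1 : volumeMeasure g ≤ a⁻¹ • volumeMeasure h := by
      refine iSup_le fun c ↦ ?_
      have h2 : chartVolume g c = a⁻¹ • chartVolume h c := by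
        rw [chartVolume_homothetic hr hgh, smul_smul, ENNReal.inv_mul_cancel ha0 hat, one_smul]
      rw [h2]
      exact hmono _ (le_iSup (chartVolume h) c)
    refine (hmono a h1).trans (le_of_eq ?_)
    rw [smul_smul, ENNReal.mul_inv_cancel ha0 hat, one_smul]

lemma vol_homothetic : vol h = ENNReal.ofReal r ^ (n / 2 : ℝ) * vol g := by
  rw [vol, volumeMeasure_homothetic hr hgh, Measure.smul_apply, smul_eq_mul, vol,
    ENNReal.ofReal_rpow_of_pos hr]

lemma inner_grad_grad_homothetic (u φ : M → ℝ) (x : M) :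
    h.inner x (grad h u x) (grad h φ x) = r⁻¹ * g.inner x (grad g u x) (grad g φ x) := by
  have hgr (u : M → ℝ) (v : TangentSpace I x) :
      r * g.inner x (grad h u x) v = g.inner x (grad g u x) v := by
    rw [← hgh, inner_grad, inner_grad]
  rw [hgh, hgr, g.symm, g.symm x (grad g u x) (grad g φ x), ← hgr φ, inv_mul_cancel_left₀ hr.ne']

lemma isNeumannSolution_homothetic_iff (μ : ℝ) (u : C^∞⟮I, M; 𝓘(ℝ, ℝ), ℝ⟯) :
    IsNeumannSolution h μ u ↔ IsNeumannSolution g (r * μ) u := by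
  have hc : (0 : ℝ) < r ^ (n / 2 : ℝ) := by positivity
  refine forall_congr' fun φ ↦ ?_
  simp_rw [inner_grad_grad_homothetic hr hgh, volumeMeasure_homothetic hr hgh,
    integral_smul_measure, integral_const_mul, ENNReal.toReal_ofReal hc.le, smul_eq_mul]
  set A := ∫ x, g.inner x (grad g u x) (grad g φ x) ∂(volumeMeasure g)
  set B := ∫ x, u x * φ x ∂(volumeMeasure g)
  constructor
  · intro h1
    have h2 : r⁻¹ * A = μ * B := mul_left_cancel₀ hc.ne' (by linarith)
    rw [mul_assoc, ← h2, mul_inv_cancel_left₀ hr.ne']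
  · intro h1
    rw [h1, mul_assoc r, inv_mul_cancel_left₀ hr.ne']
    ring

lemma spectralSpace_homothetic (L : ℝ) : spectralSpace h L = spectralSpace g (r * L) := by
  unfold spectralSpace
  congr 1
  ext u
  constructor
  · rintro ⟨μ, hμ, hu⟩
    exact ⟨r * μ, by gcongr, (isNeumannSolution_homothetic_iff hr hgh μ u).1 hu⟩
  · rintro ⟨μ, hμ, hu⟩
    refine ⟨μ / r, (div_le_iff₀' hr).2 hμ, (isNeumannSolution_homothetic_iff hr hgh _ u).2 ?_⟩
    rwa [mul_div_cancel₀ _ hr.ne']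

end Scaling

lemma spectralCount_mono (g : SmoothMetric I M) {L L' : ℝ} (hL : L ≤ L') :
    spectralCount g L ≤ spectralCount g L' := by
  refine Cardinal.toENat.monotone' (Submodule.rank_mono (Submodule.span_mono ?_))
  rintro u ⟨μ, hμ, hu⟩
  exact ⟨μ, hμ.trans hL, hu⟩

lemma le_eigenvalue_iff (g : SmoothMetric I M) (k : ℕ) (t : ℝ≥0∞) :
    t ≤ eigenvalue g k ↔ ∀ L : ℝ≥0, (L : ℝ≥0∞) < t → spectralCount g L ≤ k := by
  rw [eigenvalue, le_iInf₂_iff]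
  refine forall_congr' fun L ↦ ?_
  rw [← not_imp_not, not_le]
  refine imp_congr_right fun _ ↦ ?_
  rw [← Cardinal.natCast_le_toENat, not_le]
  change spectralCount g L < _ ↔ _
  push_cast
  exact ENat.lt_add_one_iff (by simp)

lemma one_le_spectralCount [Nonempty M] (g : SmoothMetric I M) (L : ℝ≥0) :
    1 ≤ spectralCount g L := by
  rw [spectralCount, Cardinal.one_le_toENat, Cardinal.one_le_iff_ne_zero]
  have h1 : (1 : C^∞⟮I, M; 𝓘(ℝ, ℝ), ℝ⟯) ∈ spectralSpace g L := by
    refine Submodule.subset_span ⟨0, L.coe_nonneg, fun φ ↦ ?_⟩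
    have hone (x : M) : g.inner x (grad g (1 : C^∞⟮I, M; 𝓘(ℝ, ℝ), ℝ⟯) x) (grad g φ x) = 0 := by
      rw [g.symm]
      exact inner_grad_const g φ 1 x
    simp_rw [hone]
    simp
  intro h0
  rw [rank_zero_iff] at h0
  have h2 := congrArg Subtype.val (h0.elim ⟨1, h1⟩ 0)
  obtain ⟨x⟩ := ‹Nonempty M›
  have h3 : (1 : ℝ) = 0 := congrArg (fun u : C^∞⟮I, M; 𝓘(ℝ, ℝ), ℝ⟯ ↦ u x) h2
  exact one_ne_zero h3

/-- On a connected manifold, only `λ₀` vanishes. -/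
lemma eigenvalue_pos [CompactSpace M] [ConnectedSpace M] (g : SmoothMetric I M) {k : ℕ}
    (hk : 0 < k) : 0 < eigenvalue g k := by
  obtain ⟨L, hL, h⟩ := exists_spectralSpace_le_span_one g
  refine lt_of_lt_of_le (ENNReal.coe_pos.2 hL) ((le_eigenvalue_iff g k L).2 fun L' hL' ↦ ?_)
  have h1 : spectralCount g L ≤ 1 :=
    Cardinal.toENat_le_one.2 ((Submodule.rank_mono h).trans ((rank_span_le _).trans (by simp)))
  exact (spectralCount_mono g (NNReal.coe_le_coe.2 (ENNReal.coe_le_coe.1 hL'.le))).trans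
    (h1.trans (by exact_mod_cast hk))

/-- The normalized eigenvalue in the form `λ^{n/2} Vol`. -/
lemma normalizedEigenvalue_rpow [NeZero n] (g : SmoothMetric I M) (k : ℕ) :
    normalizedEigenvalue g k ^ (n / 2 : ℝ) = eigenvalue g k ^ (n / 2 : ℝ) * vol g := by
  have hn : (n : ℝ) ≠ 0 := NeZero.ne _
  rw [normalizedEigenvalue, ENNReal.mul_rpow_of_nonneg _ _ (by positivity), ← ENNReal.rpow_mul,
    div_mul_div_cancel₀ hn, div_self two_ne_zero, ENNReal.rpow_one]

lemma conformalEigenvalue_rpow [NeZero n] (g : SmoothMetric I M) (k : ℕ) :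
    conformalEigenvalue g k ^ (n / 2 : ℝ) =
      ⨆ h ∈ conformalClass g, eigenvalue h k ^ (n / 2 : ℝ) * vol h := by
  have hn : 0 < (n / 2 : ℝ) := div_pos (Nat.cast_pos.2 (NeZero.pos n)) two_pos
  have h := (ENNReal.orderIsoRpow _ hn).map_iSup₂
    (fun (h : SmoothMetric I M) (_ : h ∈ conformalClass g) ↦ normalizedEigenvalue h k)
  simp only [ENNReal.orderIsoRpow_apply, normalizedEigenvalue_rpow] at h
  exact h

end Conformal

section SigmaConformal

variable {n : ℕ} {H : Type*} [TopologicalSpace H] [Nonempty H]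
  {I : ModelWithCorners ℝ (EuclideanSpace ℝ (Fin n)) H}
  {ι : Type} {M : ι → Type*} [∀ i, TopologicalSpace (M i)]
  [∀ i, ChartedSpace H (M i)] [∀ i, IsManifold I ∞ (M i)]

/-- The conformal class of a disjoint union is the product of the conformal classes. -/
lemma mem_conformalClass_sigma_iff (g : ∀ i, SmoothMetric I (M i))
    (h : SmoothMetric I (Σ i, M i)) :
    h ∈ conformalClass (sigmaMetric g) ↔
      ∃ h' : ∀ i, SmoothMetric I (M i), (∀ i, h' i ∈ conformalClass (g i)) ∧ h = sigmaMetric h' := by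
  constructor
  · rintro ⟨f, hf⟩
    exact ⟨fun i ↦ conformalMetric (restrictEquiv I M f i) (g i),
      fun i ↦ conformalMetric_mem _ _, metric_ext fun p v w ↦ hf p v w⟩
  · rintro ⟨h', hh', rfl⟩
    choose f hf using hh'
    exact ⟨(restrictEquiv I M).symm f, fun p v w ↦ hf p.1 p.2 v w⟩

end SigmaConformal

section Main

lemma sum_iSup_le_of_forall {ι : Type*} [Fintype ι] {X : ι → Type*} [∀ i, Nonempty (X i)]
    {F : ∀ i, X i → ℝ≥0∞} {b : ℝ≥0∞} (h : ∀ x : ∀ i, X i, ∑ i, F i (x i) ≤ b) :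
    ∑ i, ⨆ x, F i x ≤ b := by
  classical
  have h1 (i : ι) : ⨆ x, F i x = ⨆ x : ∀ i, X i, F i (x i) :=
    ((Function.surjective_eval i).iSup_comp (F i)).symm
  simp_rw [h1]
  rw [ENNReal.finsetSum_iSup]
  · exact iSup_le h
  · intro x y
    refine ⟨fun i ↦ if F i (x i) ≤ F i (y i) then y i else x i, fun i ↦ ?_⟩
    dsimp only
    split_ifs with hi
    · exact ⟨hi, le_rfl⟩
    · exact ⟨le_rfl, (not_le.1 hi).le⟩

variable {n : ℕ} {H : Type*} [TopologicalSpace H] [Nonempty H]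
  {I : ModelWithCorners ℝ (EuclideanSpace ℝ (Fin n)) H}
  {ι : Type} [Fintype ι] {M : ι → Type*} [∀ i, TopologicalSpace (M i)]
  [∀ i, ChartedSpace H (M i)] [∀ i, IsManifold I ∞ (M i)] [∀ i, CompactSpace (M i)]
  [∀ i, ConnectedSpace (M i)]

lemma eigenvalue_sigma_eq_zero (g : ∀ i, SmoothMetric I (M i)) {k : ℕ}
    (hk : k < Fintype.card ι) : eigenvalue (sigmaMetric g) k = 0 := by
  by_contra h
  have h1 := (le_eigenvalue_iff (sigmaMetric g) k _).1 le_rfl 0 (pos_iff_ne_zero.2 h)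
  rw [spectralCount_sigma] at h1
  have h2 : ∑ _i : ι, (1 : ℕ∞) ≤ k :=
    (Finset.sum_le_sum fun i _ ↦ one_le_spectralCount (g i) 0).trans h1
  rw [Finset.sum_const, Finset.card_univ, nsmul_eq_mul, mul_one] at h2
  exact absurd (Nat.cast_le.1 h2) (not_le.2 hk)

lemma conformalEigenvalue_sigma_eq_zero (g : ∀ i, SmoothMetric I (M i)) {k : ℕ}
    (hk : k < Fintype.card ι) : conformalEigenvalue (sigmaMetric g) k = 0 := by
  simp only [conformalEigenvalue, ENNReal.iSup_eq_zero]
  intro h hh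
  obtain ⟨h', -, rfl⟩ := (mem_conformalClass_sigma_iff g h).1 hh
  rw [normalizedEigenvalue, eigenvalue_sigma_eq_zero h' hk, zero_mul]

omit [∀ i, ConnectedSpace (M i)] in
/-- If `λ_{κᵢ}(Mᵢ, hᵢ) ≥ t` for all `i`, then `λ_k ≥ t` on the disjoint union, `k = ∑ κᵢ`. -/
lemma le_eigenvalue_sigma (g : ∀ i, SmoothMetric I (M i)) {κ : ι → ℕ} {t : ℝ≥0∞}
    (h : ∀ i, t ≤ eigenvalue (g i) (κ i)) : t ≤ eigenvalue (sigmaMetric g) (∑ i, κ i) := by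
  refine (le_eigenvalue_iff _ _ _).2 fun L hL ↦ ?_
  rw [spectralCount_sigma, Nat.cast_sum]
  exact Finset.sum_le_sum fun i _ ↦ (le_eigenvalue_iff _ _ _).1 (h i) L hL

/-- Conversely, a lower bound for `λ_k` on the disjoint union distributes over the components. -/
lemma exists_le_eigenvalue_of_le_sigma [Nonempty ι] (g : ∀ i, SmoothMetric I (M i)) {k : ℕ}
    {t : ℝ≥0∞} (ht : t ≠ 0) (h : t ≤ eigenvalue (sigmaMetric g) k) :
    ∃ κ : ι → ℕ, (∀ i, 0 < κ i) ∧ ∑ i, κ i = k ∧ ∀ i, t ≤ eigenvalue (g i) (κ i) := by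
  classical
  have hsum (L : ℝ≥0) (hL : (L : ℝ≥0∞) < t) : ∑ i, spectralCount (g i) L ≤ k := by
    rw [← spectralCount_sigma]
    exact (le_eigenvalue_iff _ _ _).1 h L hL
  have hle (i : ι) (L : ℝ≥0) (hL : (L : ℝ≥0∞) < t) : spectralCount (g i) L ≤ k :=
    (Finset.single_le_sum (f := fun i ↦ spectralCount (g i) L) (fun _ _ ↦ zero_le)
      (Finset.mem_univ i)).trans (hsum L hL)
  have hne : Nonempty {L : ℝ≥0 // (L : ℝ≥0∞) < t} := ⟨0, pos_iff_ne_zero.2 ht⟩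
  have hatt (i : ι) : ∃ L : {L : ℝ≥0 // (L : ℝ≥0∞) < t},
      ∀ L' : {L : ℝ≥0 // (L : ℝ≥0∞) < t}, spectralCount (g i) L' ≤ spectralCount (g i) L := by
    obtain ⟨L, hL⟩ := ENat.exists_eq_iSup_of_lt_top
      (f := fun L : {L : ℝ≥0 // (L : ℝ≥0∞) < t} ↦ spectralCount (g i) L)
      (lt_of_le_of_lt (iSup_le fun L ↦ hle i L L.2) (ENat.natCast_lt_top k))
    exact ⟨L, fun L' ↦ (le_iSup (fun L : {L : ℝ≥0 // (L : ℝ≥0∞) < t} ↦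
      spectralCount (g i) L) L').trans hL.ge⟩
  choose Lm hLm using hatt
  obtain ⟨j, -, hj⟩ := Finset.exists_max_image Finset.univ Lm Finset.univ_nonempty
  have hmax (i : ι) (L : ℝ≥0) (hL : (L : ℝ≥0∞) < t) :
      spectralCount (g i) L ≤ spectralCount (g i) (Lm j : ℝ≥0) :=
    (hLm i ⟨L, hL⟩).trans (spectralCount_mono _ (NNReal.coe_le_coe.2 (hj i (Finset.mem_univ i))))
  choose m hm using fun i ↦ ENat.ne_top_iff_exists.1
    (ne_top_of_le_ne_top (ENat.natCast_ne_top k) (hle i _ (Lm j).2))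
  have hmk : ∑ i, m i ≤ k := by
    have := hsum _ (Lm j).2
    simp_rw [← hm] at this
    exact_mod_cast this
  refine ⟨m + Pi.single j (k - ∑ i, m i), fun i ↦ ?_, ?_, fun i ↦ ?_⟩
  · have := one_le_spectralCount (g i) (Lm j : ℝ≥0)
    rw [← hm] at this
    exact Nat.add_pos_left (by exact_mod_cast this) _
  · simp only [Pi.add_apply, Finset.sum_add_distrib, Finset.sum_pi_single', Finset.mem_univ,
      if_true]
    omega
  · refine (le_eigenvalue_iff _ _ _).2 fun L hL ↦ (hmax i L hL).trans ?_
    rw [← hm]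
    exact_mod_cast Nat.le_add_right _ _

variable [NeZero n]

/-- The lower bound for the conformal eigenvalue of a disjoint union. -/
theorem sum_conformalEigenvalue_rpow_le (g : ∀ i, SmoothMetric I (M i)) {κ : ι → ℕ}
    (hκ : ∀ i, 0 < κ i) :
    ∑ i, conformalEigenvalue (g i) (κ i) ^ (n / 2 : ℝ) ≤
      conformalEigenvalue (sigmaMetric g) (∑ i, κ i) ^ (n / 2 : ℝ) := by
  have hn : 0 < (n / 2 : ℝ) := div_pos (Nat.cast_pos.2 (NeZero.pos n)) two_pos
  let X (i : ι) : Type _ := {p : SmoothMetric I (M i) × ℝ≥0 //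
    p.1 ∈ conformalClass (g i) ∧ 0 < p.2 ∧ (p.2 : ℝ≥0∞) ≤ eigenvalue p.1 (κ i)}
  have hX (i : ι) : Nonempty (X i) := by
    obtain ⟨r, hr, hr'⟩ := ENNReal.lt_iff_exists_nnreal_btwn.1 (eigenvalue_pos (g i) (hκ i))
    exact ⟨(g i, r), self_mem_conformalClass _, by exact_mod_cast hr, hr'.le⟩
  have hsup (i : ι) : conformalEigenvalue (g i) (κ i) ^ (n / 2 : ℝ) ≤
      ⨆ x : X i, (x.1.2 : ℝ≥0∞) ^ (n / 2 : ℝ) * vol x.1.1 := by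
    rw [conformalEigenvalue_rpow]
    refine iSup₂_le fun h hh ↦ ?_
    have h1 : eigenvalue h (κ i) ≤
        ⨆ r : {r : ℝ≥0 // 0 < r ∧ (r : ℝ≥0∞) ≤ eigenvalue h (κ i)}, (r.1 : ℝ≥0∞) := by
      refine le_of_forall_lt fun b hb ↦ ?_
      obtain ⟨r, hr, hr'⟩ := ENNReal.lt_iff_exists_nnreal_btwn.1 hb
      exact hr.trans_le (le_iSup (fun r : {r : ℝ≥0 // 0 < r ∧ (r : ℝ≥0∞) ≤ eigenvalue h (κ i)} ↦
        (r.1 : ℝ≥0∞)) ⟨r, ENNReal.coe_pos.1 (zero_le.trans_lt hr), hr'.le⟩)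
    have h2 := (ENNReal.orderIsoRpow _ hn).map_iSup
      (fun r : {r : ℝ≥0 // 0 < r ∧ (r : ℝ≥0∞) ≤ eigenvalue h (κ i)} ↦ (r.1 : ℝ≥0∞))
    simp only [ENNReal.orderIsoRpow_apply] at h2
    calc eigenvalue h (κ i) ^ (n / 2 : ℝ) * vol h
        ≤ (⨆ r : {r : ℝ≥0 // 0 < r ∧ (r : ℝ≥0∞) ≤ eigenvalue h (κ i)},
            (r.1 : ℝ≥0∞) ^ (n / 2 : ℝ)) * vol h := by
          rw [← h2]
          gcongr
      _ ≤ _ := by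
          rw [ENNReal.iSup_mul]
          exact iSup_le fun r ↦ le_iSup (fun x : X i ↦ (x.1.2 : ℝ≥0∞) ^ (n / 2 : ℝ) * vol x.1.1)
            ⟨(h, r.1), hh, r.2.1, r.2.2⟩
  refine (Finset.sum_le_sum fun i _ ↦ hsup i).trans (sum_iSup_le_of_forall fun x ↦ ?_)
  choose h hh hscale using fun i ↦ exists_homothetic_mem_conformalClass (x i).2.1
    (NNReal.coe_pos.2 (x i).2.2.1)
  have hvol (i : ι) : vol (h i) = ((x i).1.2 : ℝ≥0∞) ^ (n / 2 : ℝ) * vol (x i).1.1 := by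
    rw [vol_homothetic (NNReal.coe_pos.2 (x i).2.2.1) (hscale i), ENNReal.ofReal_coe_nnreal]
  have hone : 1 ≤ eigenvalue (sigmaMetric h) (∑ i, κ i) := by
    refine le_eigenvalue_sigma h fun i ↦ (le_eigenvalue_iff _ _ _).2 fun L hL ↦ ?_
    rw [spectralCount, spectralSpace_homothetic (NNReal.coe_pos.2 (x i).2.2.1) (hscale i),
      ← NNReal.coe_mul]
    refine (le_eigenvalue_iff _ _ _).1 (x i).2.2.2 _ (ENNReal.coe_lt_coe.2 ?_)
    exact mul_lt_of_lt_one_right (x i).2.2.1 (by exact_mod_cast hL)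
  simp_rw [← hvol]
  rw [← vol_sigma, conformalEigenvalue_rpow]
  refine le_trans ?_ (le_iSup₂ (f := fun (h : SmoothMetric I (Σ i, M i))
    (_ : h ∈ conformalClass (sigmaMetric g)) ↦ eigenvalue h (∑ i, κ i) ^ (n / 2 : ℝ) * vol h)
    (sigmaMetric h) ((mem_conformalClass_sigma_iff g _).2 ⟨h, hh, rfl⟩))
  exact le_mul_of_one_le_left zero_le (ENNReal.one_le_rpow hone hn)

/-- The upper bound for a metric on a disjoint union. -/
lemma exists_le_sum_conformalEigenvalue_rpow [Nonempty ι] (g : ∀ i, SmoothMetric I (M i)) {k : ℕ}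
    {h : SmoothMetric I (Σ i, M i)} (hh : h ∈ conformalClass (sigmaMetric g))
    (hpos : eigenvalue h k ≠ 0) :
    ∃ κ : ι → ℕ, (∀ i, 0 < κ i) ∧ ∑ i, κ i = k ∧ eigenvalue h k ^ (n / 2 : ℝ) * vol h ≤
      ∑ i, conformalEigenvalue (g i) (κ i) ^ (n / 2 : ℝ) := by
  obtain ⟨h', hh', rfl⟩ := (mem_conformalClass_sigma_iff g h).1 hh
  obtain ⟨κ, hκ, hsum, hle⟩ := exists_le_eigenvalue_of_le_sigma h' hpos le_rfl
  refine ⟨κ, hκ, hsum, ?_⟩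
  rw [vol_sigma, Finset.mul_sum]
  refine Finset.sum_le_sum fun i _ ↦ ?_
  rw [conformalEigenvalue_rpow]
  refine le_trans ?_ (le_iSup₂ (f := fun (h : SmoothMetric I (M i))
    (_ : h ∈ conformalClass (g i)) ↦ eigenvalue h (κ i) ^ (n / 2 : ℝ) * vol h) (h' i) (hh' i))
  gcongr
  exact hle i

/-- The conformal eigenvalues of a disjoint union. -/
theorem isGreatest_conformalEigenvalue_sigma [Nonempty ι] (g : ∀ i, SmoothMetric I (M i)) {k : ℕ}
    (hk : Fintype.card ι ≤ k) :
    IsGreatest {t : ℝ≥0∞ | ∃ κ : ι → ℕ, (∀ i, 0 < κ i) ∧ ∑ i, κ i = k ∧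
      t = ∑ i, conformalEigenvalue (g i) (κ i) ^ (n / 2 : ℝ)}
      (conformalEigenvalue (sigmaMetric g) k ^ (n / 2 : ℝ)) := by
  classical
  have hn : 0 < (n / 2 : ℝ) := div_pos (Nat.cast_pos.2 (NeZero.pos n)) two_pos
  refine ⟨?_, ?_⟩
  · set T := (Finset.univ.piAntidiag k : Finset (ι → ℕ)).filter fun κ ↦ ∀ i, 0 < κ i with hT
    have hmem (κ : ι → ℕ) : κ ∈ T ↔ ∑ i, κ i = k ∧ ∀ i, 0 < κ i := by
      simp [hT, Finset.mem_piAntidiag]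
    have hTne : T.Nonempty := by
      obtain ⟨j⟩ := ‹Nonempty ι›
      refine ⟨1 + Pi.single j (k - Fintype.card ι), (hmem _).2 ⟨?_, fun i ↦ ?_⟩⟩
      · simp only [Pi.add_apply, Pi.one_apply, Finset.sum_add_distrib, Finset.sum_const,
          Finset.card_univ, smul_eq_mul, mul_one, Finset.sum_pi_single', Finset.mem_univ, if_true]
        omega
      · exact Nat.add_pos_left one_pos _
    obtain ⟨κ, hκ, hmax⟩ := Finset.exists_max_image T
      (fun κ ↦ ∑ i, conformalEigenvalue (g i) (κ i) ^ (n / 2 : ℝ)) hTne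
    obtain ⟨hsum, hpos⟩ := (hmem κ).1 hκ
    refine ⟨κ, hpos, hsum, le_antisymm ?_ ?_⟩
    · rw [conformalEigenvalue_rpow]
      refine iSup₂_le fun h hh ↦ ?_
      by_cases h0 : eigenvalue h k = 0
      · rw [h0, ENNReal.zero_rpow_of_pos hn, zero_mul]
        exact zero_le
      · obtain ⟨κ', hκ', hsum', hle⟩ := exists_le_sum_conformalEigenvalue_rpow g hh h0
        exact hle.trans (hmax κ' ((hmem κ').2 ⟨hsum', hκ'⟩))
    · rw [← hsum]
      exact sum_conformalEigenvalue_rpow_le g hpos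
  · rintro _ ⟨κ, hpos, rfl, rfl⟩
    exact sum_conformalEigenvalue_rpow_le g hpos

end Main

end ConformalSpectrum

end

open ConformalSpectrum
theorem mainTheorem5 (n : ℕ) [NeZero n] (s : ℕ) (hs : 0 < s) (k : ℕ) (hk : 0 < k) :
    -- compact manifolds with smooth boundary, Neumann eigenvalues
    (∀ (Ω : Fin s → Type*) [∀ i, TopologicalSpace (Ω i)]
        [∀ i, ChartedSpace (EuclideanHalfSpace n) (Ω i)] [∀ i, IsManifold (𝓡∂ n) ∞ (Ω i)]
        [∀ i, T2Space (Ω i)] [∀ i, CompactSpace (Ω i)] [∀ i, ConnectedSpace (Ω i)]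
        (g : ∀ i, SmoothMetric (𝓡∂ n) (Ω i)),
      (s ≤ k → IsGreatest
        {t : ℝ≥0∞ | ∃ κ : Fin s → ℕ, (∀ i, 0 < κ i) ∧ ∑ i, κ i = k ∧
          t = ∑ i, conformalEigenvalue (g i) (κ i) ^ (n / 2 : ℝ)}
        (conformalEigenvalue (sigmaMetric g) k ^ (n / 2 : ℝ))) ∧
      (k < s → conformalEigenvalue (sigmaMetric g) k = 0)) ∧
    -- closed manifolds
    (∀ (M : Fin s → Type*) [∀ i, TopologicalSpace (M i)]
        [∀ i, ChartedSpace (EuclideanSpace ℝ (Fin n)) (M i)] [∀ i, IsManifold (𝓡 n) ∞ (M i)]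
        [∀ i, T2Space (M i)] [∀ i, CompactSpace (M i)] [∀ i, ConnectedSpace (M i)]
        (g : ∀ i, SmoothMetric (𝓡 n) (M i)),
      (s ≤ k → IsGreatest
        {t : ℝ≥0∞ | ∃ κ : Fin s → ℕ, (∀ i, 0 < κ i) ∧ ∑ i, κ i = k ∧
          t = ∑ i, conformalEigenvalue (g i) (κ i) ^ (n / 2 : ℝ)}
        (conformalEigenvalue (sigmaMetric g) k ^ (n / 2 : ℝ))) ∧
      (k < s → conformalEigenvalue (sigmaMetric g) k = 0)) := by
  have : NeZero s := ⟨hs.ne'⟩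
  refine ⟨fun Ω _ _ _ _ _ _ g ↦ ⟨fun h ↦ ?_, fun h ↦ ?_⟩,
    fun M _ _ _ _ _ _ g ↦ ⟨fun h ↦ ?_, fun h ↦ ?_⟩⟩
  · exact isGreatest_conformalEigenvalue_sigma g (by simpa using h)
  · exact conformalEigenvalue_sigma_eq_zero g (by simpa using h)
  · exact isGreatest_conformalEigenvalue_sigma g (by simpa using h)
  · exact conformalEigenvalue_sigma_eq_zero g (by simpa using h)
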